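/- **Definition.** For $r>0$, a line $\ell\subset\mathbb{R}^2$ and a continuous map $u:\mathbb{S}^1\to\mathbb{R}^2$, let $\mathcal{N}_{r/2}(\ell)$ be the open $r/2$-neighbourhood of $\ell$, and let $M_{r,\ell}(u)$ be the number of connected components $I$ of $u^{-1}(\mathcal{N}_{r/2}(\ell))$ such that $\overline{u(I)}$ intersects both components of $\partial\mathcal{N}_{r/2}(\ell)$. The $r$-multiplicity of $u$ is $M_r(u)=\sup_{\ell}M_{r,\ell}(u)$, the supremum being over all lines $\ell$ in $\mathbb{R}^2$. By the $r$-multiplicity of a simple closed curve in the plane we mean that of an injective continuous parametrization of it by $\mathbb{S}^1$; it does not depend on the parametrization. **Theorem.** Let $K\subset\mathbb{R}^2$ be nonempty, locally connected, connected and compact. For each $r>0$ there is a constant $\widetilde{C}=\widetilde{C}(r,K)$, depending only on $r$ and $K$, such that the following holds. For every connected component $\Gamma$ of $\mathbb{R}^2\setminus K$ there is a sequence $\{D_n\}$ of (closed, bounded or unbounded) polygonal regions, that is, of sets that are the closure of their nonempty connected interior, such that 1. for each $n$ the boundary $\partial D_n$ is a closed curve, namely a simple closed polygon, 2. $D_n\subset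 D_{n+1}$ for each $n$, 3. $\Gamma=\bigcup_n D_n$, and 4. $M_r(\partial D_n)<\widetilde{C}(r,K)$ for each $r>0$ and each $n$. -/

import Mathlib

open Set

/-- The Euclidean plane. -/
abbrev Plane : Type := EuclideanSpace ℝ (Fin 2)

/-- `I` is a connected component of the set `S`. -/
def IsComponentOf {X : Type*} [TopologicalSpace X] (I S : Set X) : Prop :=
  ∃ x ∈ S, connectedComponentIn S x = I

/-- `ℓ` is a line in the plane. -/
def IsLine (ℓ : AffineSubspace ℝ Plane) : Prop :=
  Module.finrank ℝ ℓ.direction = 1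

/-- The open `r`-neighbourhood of the line `ℓ`. -/
def lineNhd (r : ℝ) (ℓ : AffineSubspace ℝ Plane) : Set Plane :=
  Metric.thickening r (ℓ : Set Plane)

/-- The connected components `I` of the preimage under `u` of the open `r/2`-neighbourhood of `ℓ`
such that the closure of `u(I)` intersects every component (that is, both components) of the
boundary of this neighbourhood. -/
def crossings (r : ℝ) (ℓ : AffineSubspace ℝ Plane) (u : C(Circle, Plane)) : Set (Set Circle) :=
  {I | IsComponentOf I (u ⁻¹' lineNhd (r / 2) ℓ) ∧
    ∀ L, IsComponentOf L (frontier (lineNhd (r / 2) ℓ)) → (closure (u '' I) ∩ L).Nonempty}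

/-- The number of times that `u` crosses the open `r/2`-neighbourhood of `ℓ`. -/
noncomputable def lineMultiplicity (r : ℝ) (ℓ : AffineSubspace ℝ Plane) (u : C(Circle, Plane)) :
    ℕ∞ :=
  (crossings r ℓ u).encard

/-- The `r`-multiplicity of a closed curve: the supremum over all lines `ℓ` of the number of times
that it crosses the open `r/2`-neighbourhood of `ℓ`. -/
noncomputable def rMultiplicity (r : ℝ) (u : C(Circle, Plane)) : ℕ∞ :=
  ⨆ (ℓ : AffineSubspace ℝ Plane) (_ : IsLine ℓ), lineMultiplicity r ℓ u

/-- `u` parametrizes a simple closed polygon: it is an embedded closed curve whose image is the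
union of the edges of a closed polygonal chain (`i + 1` is cyclic in `Fin (m + 3)`). -/
def IsSimplePolygon (u : C(Circle, Plane)) : Prop :=
  Function.Injective u ∧
    ∃ (m : ℕ) (v : Fin (m + 3) → Plane), range u = ⋃ i, segment ℝ (v i) (v (i + 1))

/-- `D` is a closed polygonal region with boundary curve `u`: it is the closure of its interior,
which is nonempty and connected, and its boundary is the simple closed polygon `u`. The region may
be the bounded or the unbounded side of the polygon. -/
structure IsPolygonalRegion (D : Set Plane) (u : C(Circle, Plane)) : Prop where
  closure_interior : closure (interior D) = D
  connected : IsConnected (interior D)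
  polygon : IsSimplePolygon u
  frontier_eq : frontier D = range u

/-! Approximation: on a triangular lattice of mesh `ε`, the points whose open stars meet `K` form a
finite set `E`, connected because `K` is. A component `S` of the complement of `E` has a connected
complement and finitely many leaving edges, so interpolating its indicator affinely on triangles and
cutting at height `1 / 2` gives a region bounded by one simple polygon
(`exists_isPolygonalRegion_hexRegion`). Each component has an edge into `E`, so a scale carries only
finitely many regions, and every connected set far from `K` lies in one of them
(`exists_finite_polygonalRegions`). Exhausting a component `Γ` by connected sets at positive
distance from `K`, and choosing each region to contain the previous one and the next of these sets,
gives the sequence.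

Multiplicity: local connectedness and compactness cover `K` by `N` connected sets of diameter at
most `r / 16`. Each boundary point of a fine region is joined to `K` by a short path outside the
region. Attach each crossing to the piece of `K` reached from a point of it on the line. If three
crossings had the same piece, the outer two could be joined inside the strip, through the
surroundings of this piece, without meeting the middle one; `curves_meet` excludes this. Hence there
are at most `2 * N` crossings (`rMultiplicity_le_of_cover`). The remaining coarse scales carry
finitely many curves, each of finite multiplicity (`rMultiplicity_lt_top`). The bound is thus
uniform over all regions, hence over all `Γ`. -/

/-! ### Crossing curves in a half plane -/

/-- An angle that stays in the closed upper half circle and goes from direction `-1` to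
direction `1` decreases by exactly `π`. -/
theorem angle_eq_sub_pi {θ : ℝ → ℝ} (hθ : Continuous θ) {a b : ℝ}
    (hsin : ∀ t, 0 ≤ Real.sin (θ t)) (ha : Real.sin (θ a) = 0) (ha' : Real.cos (θ a) < 0)
    (hb : Real.sin (θ b) = 0) (hb' : 0 < Real.cos (θ b)) : θ b = θ a - Real.pi := by
  have hpi := Real.pi_pos
  have hsub : Real.sin (θ b - θ a) = 0 := by rw [Real.sin_sub, ha, hb]; ring
  obtain ⟨n, hn⟩ := Real.sin_eq_zero_iff.1 hsub
  have hcos : Real.cos (n * Real.pi) < 0 := by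
    rw [hn, Real.cos_sub, ha, hb, zero_mul, add_zero]
    exact mul_neg_of_pos_of_neg hb' ha'
  have hodd : ¬ Even n := by
    rintro ⟨m, rfl⟩
    have : ((m + m : ℤ) : ℝ) * Real.pi = m * (2 * Real.pi) := by push_cast; ring
    rw [this, Real.cos_int_mul_two_pi] at hcos
    linarith
  have key : ∀ v, Real.sin v < 0 → v ∉ uIcc (θ a) (θ b) := by
    intro v hv hmem
    obtain ⟨t, -, ht⟩ := intermediate_value_uIcc (a := a) (b := b) hθ.continuousOn hmem
    have := hsin t
    rw [ht] at this
    linarith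
  -- The sine is negative at `θ a + π / 2` and at `θ a - 3 * π / 2`, so the angle is trapped between
  -- these values and only the odd multiple `-1` of `π` remains.
  have h1 := key (θ a + Real.pi / 2) (by rw [Real.sin_add_pi_div_two]; exact ha')
  have h2 := key (θ a + Real.pi / 2 - 2 * Real.pi)
    (by rw [Real.sin_sub_two_pi, Real.sin_add_pi_div_two]; exact ha')
  have hn' : n = -1 := by
    by_contra hne
    rcases lt_or_gt_of_ne hne with h | h
    · have : n ≤ -2 := by omega
      have : (n : ℝ) ≤ -2 := by exact_mod_cast this
      exact h2 (mem_uIcc.2 (Or.inr ⟨by nlinarith, by nlinarith⟩))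
    · have h0 : n ≠ 0 := by rintro rfl; simp at hodd
      have : 1 ≤ n := by omega
      have : (1 : ℝ) ≤ n := by exact_mod_cast this
      exact h1 (mem_uIcc.2 (Or.inl ⟨by nlinarith, by nlinarith⟩))
  rw [hn'] at hn
  push_cast at hn
  linarith

/-- In the closed upper half plane, a curve `P` that joins two points of the boundary line crosses
every curve `A` that starts between these two points and reaches the height of `P`. -/
theorem curves_meet {P A : ℝ → ℂ} (hP : Continuous P) (hA : Continuous A) {c : ℝ}
    (hP0 : (P 0).im = c) (hP1 : (P 1).im = c) (hA0 : (A 0).im = c)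
    (h0 : (P 0).re < (A 0).re) (h1 : (A 0).re < (P 1).re) (hPc : ∀ s, c ≤ (P s).im)
    (hAc : ∀ t, c ≤ (A t).im) (htop : ∀ s, (P s).im ≤ (A 1).im) : ∃ s t, P s = A t := by
  by_contra! hne
  -- If the curves are disjoint, `P s - A t` has a continuous logarithm on the simply connected
  -- parameter plane. Two paths from `(0, 0)` to `(1, 0)` will give different changes of its
  -- argument.
  obtain ⟨L, hL, hLexp⟩ := Complex.exists_continuousOn_eqOn_exp_comp (X := ℝ × ℝ) (U := univ)
    (g := fun x => P x.1 - A x.2)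
    ((Homeomorph.Set.univ (ℝ × ℝ)).toHomotopyEquiv.simplyConnectedSpace_iff.2 inferInstance) isOpen_univ
    (by fun_prop)
    (by rintro ⟨x, -, hx⟩; exact hne x.1 x.2 (sub_eq_zero.1 hx))
  have hLc : Continuous L := continuousOn_univ.1 hL
  have hexp : ∀ s t, Complex.exp (L (s, t)) = P s - A t := fun s t => hLexp (mem_univ (s, t))
  have him : ∀ s t, (P s - A t).im = Real.exp (L (s, t)).re * Real.sin (L (s, t)).im := by
    intro s t; rw [← hexp, Complex.exp_im]
  have hre : ∀ s t, (P s - A t).re = Real.exp (L (s, t)).re * Real.cos (L (s, t)).im := by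
    intro s t; rw [← hexp, Complex.exp_re]
  have spos : ∀ s t, 0 ≤ (P s - A t).im → 0 ≤ Real.sin (L (s, t)).im := by
    intro s t h; rw [him] at h
    exact nonneg_of_mul_nonneg_right h (Real.exp_pos _)
  have sneg : ∀ s t, (P s - A t).im ≤ 0 → Real.sin (L (s, t)).im ≤ 0 := by
    intro s t h; rw [him] at h
    exact nonpos_of_mul_nonpos_right h (Real.exp_pos _)
  have szero : ∀ s t, (P s - A t).im = 0 → Real.sin (L (s, t)).im = 0 := fun s t h =>
    le_antisymm (sneg s t h.le) (spos s t h.ge)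
  have z0 : Real.sin (L (0, 0)).im = 0 := szero 0 0 (by simp [hP0, hA0])
  have z1 : Real.sin (L (1, 0)).im = 0 := szero 1 0 (by simp [hP1, hA0])
  have c0 : Real.cos (L (0, 0)).im < 0 := by
    have h := hre 0 0
    rw [Complex.sub_re] at h
    by_contra! hc
    have := mul_nonneg (Real.exp_pos (L (0, 0)).re).le hc
    linarith
  have c1 : 0 < Real.cos (L (1, 0)).im := by
    have h := hre 1 0
    rw [Complex.sub_re] at h
    by_contra! hc
    have := mul_nonpos_of_nonneg_of_nonpos (Real.exp_pos (L (1, 0)).re).le hc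
    linarith
  have e1 := angle_eq_sub_pi (θ := fun s => (L (s, 0)).im) (a := 0) (b := 1) (by fun_prop)
    (fun s => spos s 0 (by simp [hA0, hPc])) z0 c0 z1 c1
  -- `w` follows the other three sides of the unit square, `(0, 0)`, `(0, 1)`, `(1, 1)`, `(1, 0)`.
  -- There `P s - A t` stays in the lower half plane, so the argument grows by `π`, whereas along `t
  -- = 0` it drops by `π`.
  set w : ℝ → ℝ × ℝ := fun τ => (max 0 (min 1 (τ - 1)), max 0 (min 1 (min τ (3 - τ)))) with hw
  have hwc : Continuous w := by fun_prop
  have w0 : w 0 = (0, 0) := by simp [hw]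
  have w3 : w 3 = (1, 0) := by norm_num [hw]
  have hwneg : ∀ τ, Real.sin (L (w τ)).im ≤ 0 := by
    intro τ
    apply sneg
    rw [Complex.sub_im]
    rcases le_total τ 1 with h | h
    · have : max 0 (min 1 (τ - 1)) = 0 := by
        rw [max_eq_left]; exact (min_le_right _ _).trans (by linarith)
      rw [this, hP0]; linarith [hAc (max 0 (min 1 (min τ (3 - τ))))]
    rcases le_total τ 2 with h' | h'
    · have : max 0 (min 1 (min τ (3 - τ))) = 1 := by
        rw [min_eq_left, max_eq_right zero_le_one]
        exact le_min h (by linarith)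
      rw [this]; linarith [htop (max 0 (min 1 (τ - 1)))]
    · have : max 0 (min 1 (τ - 1)) = 1 := by
        rw [min_eq_left (by linarith), max_eq_right zero_le_one]
      rw [this, hP1]; linarith [hAc (max 0 (min 1 (min τ (3 - τ))))]
  have e2 := angle_eq_sub_pi (θ := fun τ => -(L (w τ)).im) (a := 0) (b := 3) (by fun_prop)
    (fun s => by rw [Real.sin_neg]; linarith [hwneg s]) (by rw [w0, Real.sin_neg, z0, neg_zero])
    (by rw [w0, Real.cos_neg]; exact c0) (by rw [w3, Real.sin_neg, z1, neg_zero])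
    (by rw [w3, Real.cos_neg]; exact c1)
  rw [w0, w3] at e2
  linarith [Real.pi_pos]

/-! ### Strips in complex coordinates and arcs inside crossings -/

/-- A line is the real axis of a suitable isometric complex coordinate of the plane. -/
theorem IsLine.exists_isometryEquiv_complex {ℓ : AffineSubspace ℝ Plane} (hℓ : IsLine ℓ) :
    ∃ ψ : Plane ≃ᵢ ℂ, ∀ x, x ∈ ℓ ↔ (ψ x).im = 0 := by
  obtain ⟨⟨v, hv⟩, hv0, hspan⟩ := finrank_eq_one_iff'.1 hℓ
  have hv1 : v ≠ 0 := fun h => hv0 (Subtype.ext h)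
  have hne : (ℓ : Set Plane).Nonempty := by
    by_contra h
    rw [not_nonempty_iff_eq_empty, AffineSubspace.coe_eq_bot_iff] at h
    subst h
    rw [AffineSubspace.direction_bot, Submodule.mem_bot] at hv
    exact hv1 hv
  obtain ⟨q, hq⟩ := hne
  set z := Complex.orthonormalBasisOneI.repr.symm with hz
  have hzv : z v ≠ 0 := fun h => hv1 (z.injective (h.trans (map_zero z).symm))
  have hnorm : (‖z v‖ : ℝ) ≠ 0 := norm_ne_zero_iff.2 hzv
  obtain ⟨c, hc⟩ : ∃ c : Circle, (c : ℂ) = z v / ‖z v‖ := ⟨⟨z v / ‖z v‖, by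
    refine mem_sphere_zero_iff_norm.2 ?_
    rw [norm_div, Complex.norm_real, norm_norm, div_self hnorm]⟩, rfl⟩
  obtain ⟨T, hT⟩ : ∃ T : Plane ≃ₗᵢ[ℝ] ℂ, T = z.trans (rotation c⁻¹) := ⟨_, rfl⟩
  have hTv : T v = (‖z v‖ : ℂ) := by
    simp only [hT, LinearIsometryEquiv.trans_apply, rotation_apply, Circle.coe_inv]
    rw [hc, inv_div, div_mul_cancel₀ _ hzv]
  refine ⟨(IsometryEquiv.subRight q).trans T.toIsometryEquiv, fun x => ?_⟩
  have hmem : x ∈ ℓ ↔ x - q ∈ ℓ.direction := (AffineSubspace.vsub_right_mem_direction_iff_mem hq x).symm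
  rw [hmem]
  simp only [IsometryEquiv.trans_apply, IsometryEquiv.subRight_apply,
    LinearIsometryEquiv.coe_toIsometryEquiv]
  constructor
  · intro hx
    obtain ⟨t, ht⟩ := hspan ⟨x - q, hx⟩
    have ht : t • v = x - q := congrArg Subtype.val ht
    rw [← ht, map_smul, hTv]
    simp
  · intro hx
    have : x - q = ((T (x - q)).re / ‖z v‖) • v := by
      apply T.injective
      rw [map_smul, hTv]
      generalize T (x - q) = y at hx
      clear hc hTv
      generalize ‖z v‖ = a at hnorm
      apply Complex.ext
      · simp [hnorm]
      · simp [hx]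
    rw [this]
    exact ℓ.direction.smul_mem _ hv

theorem lineNhd_eq_preimage {ℓ : AffineSubspace ℝ Plane} {ψ : Plane ≃ᵢ ℂ}
    (hψ : ∀ x, x ∈ ℓ ↔ (ψ x).im = 0) (r : ℝ) : lineNhd r ℓ = {x | |(ψ x).im| < r} := by
  ext x
  rw [lineNhd, Metric.mem_thickening_iff, mem_ofPred_eq]
  constructor
  · rintro ⟨y, hy, hxy⟩
    rw [← ψ.dist_eq, Complex.dist_eq] at hxy
    have := Complex.abs_im_le_norm (ψ x - ψ y)
    rw [Complex.sub_im, (hψ y).1 hy, sub_zero] at this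
    linarith
  · intro h
    refine ⟨ψ.symm (ψ x).re, (hψ _).2 (by simp), ?_⟩
    rw [← ψ.dist_eq, ψ.apply_symm_apply, Complex.dist_of_re_eq (by simp)]
    simpa [Real.dist_eq] using h

theorem frontier_lineNhd {ℓ : AffineSubspace ℝ Plane} {ψ : Plane ≃ᵢ ℂ}
    (hψ : ∀ x, x ∈ ℓ ↔ (ψ x).im = 0) {r : ℝ} (hr : 0 < r) :
    frontier (lineNhd r ℓ) = {x | (ψ x).im = -r ∨ (ψ x).im = r} := by
  have h1 : lineNhd r ℓ = ψ.toHomeomorph ⁻¹' (Complex.im ⁻¹' Ioo (-r) r) := by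
    rw [lineNhd_eq_preimage hψ]
    ext x
    simp [abs_lt]
  rw [h1, ← Homeomorph.preimage_frontier, Complex.frontier_preimage_im, frontier_Ioo (by linarith)]
  ext x
  simp

/-- A crossing contains points close to both sides of the neighbourhood of the line. -/
theorem exists_mem_crossing {ℓ : AffineSubspace ℝ Plane} {ψ : Plane ≃ᵢ ℂ}
    (hψ : ∀ x, x ∈ ℓ ↔ (ψ x).im = 0) {r : ℝ} (hr : 0 < r) {u : C(Circle, Plane)} {I : Set Circle}
    (hI : I ∈ crossings r ℓ u) {s : ℝ} (hs : s < r / 2) :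
    (∃ x ∈ I, (ψ (u x)).im < -s) ∧ ∃ x ∈ I, s < (ψ (u x)).im := by
  have hF := frontier_lineNhd hψ (half_pos hr)
  have hψc : Continuous fun x => (ψ x).im := Complex.continuous_im.comp ψ.continuous
  have key : ∀ x ∈ frontier (lineNhd (r / 2) ℓ),
      ∃ z ∈ closure (u '' I), (ψ z).im = (ψ x).im := by
    intro x hx
    obtain ⟨z, hz, hzL⟩ := hI.2 _ ⟨x, hx, rfl⟩
    refine ⟨z, hz, ?_⟩
    have hpre := (isPreconnected_connectedComponentIn (x := x)
      (F := frontier (lineNhd (r / 2) ℓ))).image _ hψc.continuousOn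
    have hzF := connectedComponentIn_subset _ _ hzL
    -- The height does not vanish on the frontier, so a connected subset of it stays on one boundary
    -- line; the components need not be determined exactly.
    have hsub : (0 : ℝ) ∉ (fun x => (ψ x).im) '' connectedComponentIn (frontier (lineNhd (r / 2) ℓ)) x := by
      rintro ⟨w, hw, hw0⟩
      have := connectedComponentIn_subset _ _ hw
      rw [hF] at this
      rcases this with h | h <;> simp only [h] at hw0 <;> linarith
    by_contra hne
    apply hsub
    have hxm := mem_image_of_mem (fun x => (ψ x).im) (mem_connectedComponentIn hx)
    have hzm := mem_image_of_mem (fun x => (ψ x).im) hzL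
    rw [hF] at hx hzF
    rcases hx with hx | hx <;> rcases hzF with hzF | hzF
    · exact absurd (hzF.trans hx.symm) hne
    · refine hpre.ordConnected.out hxm hzm ⟨?_, ?_⟩ <;> simp only [hx, hzF] <;> linarith
    · refine hpre.ordConnected.out hzm hxm ⟨?_, ?_⟩ <;> simp only [hx, hzF] <;> linarith
    · exact absurd (hzF.trans hx.symm) hne
  constructor
  · obtain ⟨z, hz, hzx⟩ := key (ψ.symm ⟨0, -(r / 2)⟩) (by rw [hF]; left; simp)
    rw [ψ.apply_symm_apply] at hzx
    obtain ⟨_, hw, x, hx, rfl⟩ := mem_closure_iff.1 hz {w | (ψ w).im < -s}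
      (isOpen_lt hψc continuous_const) (by rw [mem_ofPred_eq, hzx]; simp only; linarith)
    exact ⟨x, hx, hw⟩
  · obtain ⟨z, hz, hzx⟩ := key (ψ.symm ⟨0, r / 2⟩) (by rw [hF]; right; simp)
    rw [ψ.apply_symm_apply] at hzx
    obtain ⟨_, hw, x, hx, rfl⟩ := mem_closure_iff.1 hz {w | s < (ψ w).im}
      (isOpen_lt continuous_const hψc) (by rw [mem_ofPred_eq, hzx]; simp only; linarith)
    exact ⟨x, hx, hw⟩

/-- Needed to find paths inside crossings, which are open connected subsets of the circle, and to
cover the circle by small connected sets. -/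
instance : LocallyPathConnectedSpace Circle :=
  Circle.isAddQuotientCoveringMap_exp.toIsQuotientMap.locallyPathConnectedSpace

/-- A continuous map from a compact locally connected space to a metric space has small values on
each set of a suitable finite cover by connected sets. -/
theorem exists_finite_preconnected_cover {X Y : Type*} [TopologicalSpace X] [CompactSpace X]
    [LocallyConnectedSpace X] [PseudoMetricSpace Y] {f : X → Y} (hf : Continuous f) {η : ℝ}
    (hη : 0 < η) : ∃ (s : Finset X) (W : X → Set X), (∀ x, IsPreconnected (W x)) ∧
      (∀ x, ∀ a ∈ W x, ∀ b ∈ W x, dist (f a) (f b) ≤ η) ∧ ∀ a, ∃ x ∈ s, a ∈ W x := by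
  have hopen : ∀ x, IsOpen (f ⁻¹' Metric.ball (f x) (η / 2)) := fun x =>
    Metric.isOpen_ball.preimage hf
  have hx : ∀ x, x ∈ f ⁻¹' Metric.ball (f x) (η / 2) := fun x =>
    Metric.mem_ball_self (half_pos hη)
  obtain ⟨s, hs⟩ := (isCompact_univ (X := X)).elim_finite_subcover
    (fun x => connectedComponentIn (f ⁻¹' Metric.ball (f x) (η / 2)) x)
    (fun x => (hopen x).connectedComponentIn)
    (fun x _ => mem_iUnion.2 ⟨x, mem_connectedComponentIn (hx x)⟩)
  refine ⟨s, fun x => connectedComponentIn (f ⁻¹' Metric.ball (f x) (η / 2)) x,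
    fun x => isPreconnected_connectedComponentIn, fun x a ha b hb => ?_, fun a => ?_⟩
  · have ha := connectedComponentIn_subset _ _ ha
    have hb := connectedComponentIn_subset _ _ hb
    rw [mem_preimage, Metric.mem_ball] at ha hb
    linarith [dist_triangle_right (f a) (f b) (f x)]
  · obtain ⟨x, hxs, hax⟩ := mem_iUnion₂.1 (hs (mem_univ a))
    exact ⟨x, hxs, hax⟩

theorem IsComponentOf.eq_of_mem {X : Type*} [TopologicalSpace X] {I J S : Set X}
    (hI : IsComponentOf I S) (hJ : IsComponentOf J S) {x : X} (hxI : x ∈ I) (hxJ : x ∈ J) :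
    I = J := by
  obtain ⟨y, -, rfl⟩ := hI
  obtain ⟨z, -, rfl⟩ := hJ
  rw [connectedComponentIn_eq hxI, connectedComponentIn_eq hxJ]

theorem IsComponentOf.subset {X : Type*} [TopologicalSpace X] {I S : Set X}
    (hI : IsComponentOf I S) : I ⊆ S := by
  obtain ⟨y, -, rfl⟩ := hI
  exact connectedComponentIn_subset _ _

theorem IsComponentOf.isPreconnected {X : Type*} [TopologicalSpace X] {I S : Set X}
    (hI : IsComponentOf I S) : IsPreconnected I := by
  obtain ⟨y, -, rfl⟩ := hI
  exact isPreconnected_connectedComponentIn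

theorem IsComponentOf.subset_of_isPreconnected {X : Type*} [TopologicalSpace X] {I S V : Set X}
    (hI : IsComponentOf I S) (hV : IsPreconnected V) (hVS : V ⊆ S) {x : X} (hxI : x ∈ I)
    (hxV : x ∈ V) : V ⊆ I := by
  obtain ⟨y, -, rfl⟩ := hI
  rw [connectedComponentIn_eq hxI]
  exact hV.subset_connectedComponentIn hxV hVS

/-- A real function that climbs from below `-s` to above `s` does so within some interval on which
its values lie between `-s` and `s`. -/
theorem exists_Icc_climb {g : ℝ → ℝ} (hg : Continuous g) {s : ℝ} (hs : 0 < s) (h0 : g 0 < -s)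
    (h1 : s < g 1) : ∃ a b, 0 ≤ a ∧ a ≤ b ∧ b ≤ 1 ∧ g a = -s ∧ g b = s ∧
      ∀ t ∈ Icc a b, |g t| ≤ s := by
  have hB : IsCompact (Icc (0 : ℝ) 1 ∩ {t | s ≤ g t}) :=
    isCompact_Icc.inter_right (isClosed_le continuous_const hg)
  -- `b` is the first time at which `s` is reached; `a` below is the last time before `b` at which
  -- the value is at most `-s`.
  obtain ⟨b, ⟨hb, hbs⟩, hbmin⟩ := hB.exists_isLeast ⟨1, ⟨zero_le_one, le_rfl⟩, h1.le⟩
  have hlt : ∀ t ∈ Icc 0 b, t ≠ b → g t < s := by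
    intro t ht htb
    by_contra! h
    exact htb (le_antisymm ht.2 (hbmin ⟨⟨ht.1, ht.2.trans hb.2⟩, h⟩))
  have hgb : g b = s := by
    refine le_antisymm ?_ hbs
    by_contra! h
    obtain ⟨t, ht, hts⟩ := intermediate_value_Icc hb.1 hg.continuousOn
      (show s ∈ Icc (g 0) (g b) from ⟨by linarith, hbs⟩)
    rcases eq_or_ne t b with rfl | hne
    · linarith
    · linarith [hlt t ht hne]
  have hA : IsCompact (Icc (0 : ℝ) b ∩ {t | g t ≤ -s}) :=
    isCompact_Icc.inter_right (isClosed_le hg continuous_const)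
  obtain ⟨a, ⟨ha, has⟩, hamax⟩ := hA.exists_isGreatest ⟨0, ⟨le_rfl, hb.1⟩, h0.le⟩
  have hgt : ∀ t ∈ Icc a b, t ≠ a → -s < g t := by
    intro t ht hta
    by_contra! h
    exact hta (le_antisymm (hamax ⟨⟨ha.1.trans ht.1, ht.2⟩, h⟩) ht.1)
  have hga : g a = -s := by
    refine le_antisymm has ?_
    by_contra! h
    obtain ⟨t, ht, hts⟩ := intermediate_value_Icc ha.2 hg.continuousOn
      (show -s ∈ Icc (g a) (g b) from ⟨has, by linarith⟩)
    rcases eq_or_ne t a with rfl | hne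
    · linarith
    · linarith [hgt t ht hne]
  refine ⟨a, b, ha.1, ha.2, hb.2, hga, hgb, fun t ht => abs_le.2 ⟨?_, ?_⟩⟩
  · rcases eq_or_ne t a with rfl | hne
    · exact hga.ge
    · exact (hgt t ht hne).le
  · rcases eq_or_ne t b with rfl | hne
    · exact hgb.le
    · exact (hlt t ⟨ha.1.trans ht.1, ht.2⟩ hne).le

/-- A crossing contains an arc that joins the two sides of a narrower strip within this strip. -/
theorem exists_arc_of_mem_crossings {ℓ : AffineSubspace ℝ Plane} {ψ : Plane ≃ᵢ ℂ}
    (hψ : ∀ x, x ∈ ℓ ↔ (ψ x).im = 0) {r : ℝ} {u : C(Circle, Plane)} {I : Set Circle}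
    (hI : I ∈ crossings r ℓ u) {s : ℝ} (hs0 : 0 < s) (hs : s < r / 2) :
    ∃ α : ℝ → Plane, Continuous α ∧ (∀ t, α t ∈ u '' I) ∧ (ψ (α 0)).im = -s ∧
      (ψ (α 1)).im = s ∧ (∀ t, |(ψ (α t)).im| ≤ s) ∧ ∃ t, (ψ (α t)).im = 0 := by
  have hψc : Continuous fun x => (ψ x).im := Complex.continuous_im.comp ψ.continuous
  obtain ⟨⟨x, hx, hxs⟩, y, hy, hys⟩ := exists_mem_crossing hψ (by linarith) hI hs
  have hIo : IsOpen I := by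
    obtain ⟨z, hz, rfl⟩ := hI.1
    exact (Metric.isOpen_thickening.preimage u.continuous).connectedComponentIn
  have hIp : IsPathConnected I :=
    hIo.isConnected_iff_isPathConnected.1 ⟨⟨x, hx⟩, hI.1.isPreconnected⟩
  obtain ⟨γ, hγ⟩ := hIp.joinedIn x hx y hy
  have hγe : ∀ t, γ.extend t ∈ I := fun t => by
    obtain ⟨t', ht'⟩ : γ.extend t ∈ range γ := γ.extend_range ▸ mem_range_self t
    exact ht' ▸ hγ t'
  obtain ⟨a, b, ha, hab, hb, hga, hgb, hgt⟩ := exists_Icc_climb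
    (g := fun t => (ψ (u (γ.extend t))).im)
    (hψc.comp (u.continuous.comp γ.continuous_extend)) hs0 (by simpa using hxs) (by simpa using hys)
  -- Clamping keeps all real parameters inside the climb, so the bounds on the arc hold for every
  -- `t`.
  set τ : ℝ → ℝ := fun t => a + (b - a) * max 0 (min 1 t) with hτ
  have hτI : ∀ t, τ t ∈ Icc a b := by
    intro t
    have h1 : 0 ≤ max 0 (min 1 t) := le_max_left _ _
    have h2 : max 0 (min 1 t) ≤ 1 := max_le zero_le_one (min_le_left _ _)
    constructor <;> simp only [hτ] <;> nlinarith
  have hτc : Continuous τ := by fun_prop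
  have hαc : Continuous fun t => u (γ.extend (τ t)) :=
    u.continuous.comp (γ.continuous_extend.comp hτc)
  have hα0 : (ψ (u (γ.extend (τ 0)))).im = -s := by simpa [hτ] using hga
  have hα1 : (ψ (u (γ.extend (τ 1)))).im = s := by simpa [hτ] using hgb
  refine ⟨_, hαc, fun t => mem_image_of_mem u (hγe _), hα0, hα1, fun t => hgt _ (hτI t), ?_⟩
  obtain ⟨t, -, ht⟩ := intermediate_value_Icc zero_le_one (hψc.comp hαc).continuousOn
    (show (0 : ℝ) ∈ Icc _ _ from ⟨by simpa [hα0] using hs0.le, by simpa [hα1] using hs0.le⟩)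
  exact ⟨t, ht⟩

/-! ### Bounds for the multiplicity -/

/-- The `r`-multiplicity of a closed curve is finite. -/
theorem rMultiplicity_lt_top {r : ℝ} (hr : 0 < r) (u : C(Circle, Plane)) :
    rMultiplicity r u < ⊤ := by
  obtain ⟨s, W, hWc, hWd, hW⟩ := exists_finite_preconnected_cover u.continuous
    (show 0 < r / 4 by linarith)
  refine lt_of_le_of_lt (iSup₂_le fun ℓ hℓ => ?_) (ENat.natCast_lt_top s.card)
  obtain ⟨ψ, hψ⟩ := hℓ.exists_isometryEquiv_complex
  have h0 : ∀ I ∈ crossings r ℓ u, ∃ y ∈ I, (ψ (u y)).im = 0 := by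
    intro I hI
    obtain ⟨α, -, hα, -, -, -, t, ht⟩ := exists_arc_of_mem_crossings hψ hI
      (show 0 < r / 4 by linarith) (by linarith)
    obtain ⟨y, hy, hyα⟩ := hα t
    exact ⟨y, hy, by rw [hyα, ht]⟩
  choose! y hyI hy0 using h0
  choose j hjs hj using hW
  rw [lineMultiplicity, ← Set.encard_coe_eq_coe_finsetCard]
  refine Set.encard_le_encard_of_injOn (f := fun I => j (y I)) (fun I _ => hjs _) ?_
  intro I hI I' hI' heq
  -- A piece containing a point on the line stays within `r / 4` of the line, hence lies inside one
  -- crossing; distinct crossings therefore use distinct pieces.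
  have hsub : W (j (y I)) ⊆ u ⁻¹' lineNhd (r / 2) ℓ := by
    intro x hx
    rw [lineNhd_eq_preimage hψ, mem_preimage, mem_ofPred_eq]
    have h := hWd _ x hx _ (hj (y I))
    rw [← ψ.dist_eq, Complex.dist_eq] at h
    have h2 := Complex.abs_im_le_norm (ψ (u x) - ψ (u (y I)))
    rw [Complex.sub_im, hy0 I hI, sub_zero] at h2
    linarith
  have h1 := hI.1.subset_of_isPreconnected (hWc _) hsub (hyI I hI) (hj _)
  refine hI.1.eq_of_mem hI'.1 (h1 ?_) (hyI I' hI')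
  change j (y I) = j (y I') at heq
  rw [heq]
  exact hj _

/-- If the points of the boundary curve `u` of `D` can be reached by short paths outside `D` from
`K`, and `K` has a cover by `N` small connected sets, then `u` has at most `2 * N` crossings. -/
theorem rMultiplicity_le_of_cover {r : ℝ} (hr : 0 < r) {K D : Set Plane} {u : C(Circle, Plane)}
    (hu : Function.Injective u) (hD : IsClosed D) (hKD : Disjoint K D) (huD : range u ⊆ D)
    (hvis : ∀ p ∈ range u, ∃ k ∈ K, JoinedIn (insert p (Dᶜ ∩ Metric.closedBall p (r / 16))) p k)
    {ι : Type*} [Nonempty ι] (s : Finset ι) (W : ι → Set Plane) (hWK : ∀ i, W i ⊆ K)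
    (hWc : ∀ i, IsPreconnected (W i)) (hWd : ∀ i, ∀ a ∈ W i, ∀ b ∈ W i, dist a b ≤ r / 16)
    (hW : ∀ k ∈ K, ∃ i ∈ s, k ∈ W i) : rMultiplicity r u ≤ (2 * s.card : ℕ) := by
  classical
  refine iSup₂_le fun ℓ hℓ => ?_
  obtain ⟨ψ, hψ⟩ := hℓ.exists_isometryEquiv_complex
  have hψc : Continuous fun x => (ψ x).im := Complex.continuous_im.comp ψ.continuous
  have him : ∀ x y, |(ψ x).im| ≤ |(ψ y).im| + dist x y := by
    intro x y
    rw [← ψ.dist_eq, Complex.dist_eq]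
    have h2 := Complex.abs_im_le_norm (ψ x - ψ y)
    rw [Complex.sub_im] at h2
    have := abs_sub_abs_le_abs_sub (ψ x).im (ψ y).im
    linarith
  have H : ∀ I ∈ crossings r ℓ u, ∃ α : ℝ → Plane, Continuous α ∧ (∀ t, α t ∈ u '' I) ∧
      (ψ (α 0)).im = -(r / 4) ∧ (ψ (α 1)).im = r / 4 ∧ (∀ t, |(ψ (α t)).im| ≤ r / 4) ∧
      ∃ t, ∃ k, ∃ i ∈ s, (ψ (α t)).im = 0 ∧ k ∈ W i ∧
        JoinedIn (insert (α t) (Dᶜ ∩ Metric.closedBall (α t) (r / 16))) (α t) k := by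
    intro I hI
    obtain ⟨α, h1, h2, h3, h4, h5, t, ht⟩ := exists_arc_of_mem_crossings hψ hI
      (show 0 < r / 4 by linarith) (by linarith)
    obtain ⟨k, hk, hj⟩ := hvis (α t) (image_subset_range u I (h2 t))
    obtain ⟨i, hi, hki⟩ := hW k hk
    exact ⟨α, h1, h2, h3, h4, h5, t, k, i, hi, ht, hki, hj⟩
  choose! α hαc hαI hα0 hα1 hαs t k i his ht hki hjoin using H
  have hdisj : ∀ I ∈ crossings r ℓ u, ∀ J ∈ crossings r ℓ u, I ≠ J → ∀ a b, α I a ≠ α J b := by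
    intro I hI J hJ hne a b hab
    obtain ⟨x, hx, hxa⟩ := hαI I hI a
    obtain ⟨y, hy, hyb⟩ := hαI J hJ b
    have : x = y := hu (by rw [hxa, hyb, hab])
    subst this
    exact hne (hI.1.eq_of_mem hJ.1 hx hy)
  have hαD : ∀ I ∈ crossings r ℓ u, ∀ a, α I a ∈ D := fun I hI a =>
    huD (image_subset_range u I (hαI I hI a))
  -- The arc of `J`, starting between the other two, climbs through the whole strip `|im| ≤ r / 4`.
  -- The plan is to join `I` to `L` inside `Y`, that is, in this strip off the arc of `J`.
  have hbetween : ∀ I ∈ crossings r ℓ u, ∀ J ∈ crossings r ℓ u, ∀ L ∈ crossings r ℓ u,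
      I ≠ J → L ≠ J → i I = i L → (ψ (α I 0)).re < (ψ (α J 0)).re →
      (ψ (α J 0)).re < (ψ (α L 0)).re → False := by
    intro I hI J hJ L hL hIJ hLJ hil h1 h2
    set Y : Set Plane := {x | |(ψ x).im| ≤ r / 4} ∩ (range (α J))ᶜ with hY
    have harc : ∀ M ∈ crossings r ℓ u, M ≠ J → ∀ a b, JoinedIn Y (α M a) (α M b) := by
      intro M hM hMJ a b
      have hr' : IsPathConnected (range (α M)) := isPathConnected_range (hαc M hM)
      refine (hr'.joinedIn _ (mem_range_self a) _ (mem_range_self b)).mono ?_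
      rintro _ ⟨c, rfl⟩
      refine ⟨hαs M hM c, ?_⟩
      rintro ⟨d, hd⟩
      exact hdisj M hM J hJ hMJ c d hd.symm
    have hball : ∀ M ∈ crossings r ℓ u, M ≠ J → JoinedIn Y (α M (t M)) (k M) := by
      intro M hM hMJ
      refine (hjoin M hM).mono (insert_subset (harc M hM hMJ (t M) (t M)).source_mem ?_)
      rintro x ⟨hxD, hxb⟩
      refine ⟨?_, ?_⟩
      · have := him x (α M (t M))
        rw [ht M hM, abs_zero, zero_add] at this
        rw [mem_ofPred_eq]
        linarith [Metric.mem_closedBall.1 hxb]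
      · rintro ⟨d, rfl⟩
        exact hxD (hαD J hJ d)
    have hmid : JoinedIn Y (k I) (k L) := by
      -- The piece `W (i I)` is only connected, not path connected, so the path runs in a component
      -- of the open set `O` around it. The piece lies in `O` because its heights are at most `r /
      -- 16 + r / 16 < r / 4`.
      set O : Set Plane := {x | |(ψ x).im| < r / 4} ∩ Dᶜ with hO
      have hOo : IsOpen O := (isOpen_lt hψc.abs continuous_const).inter hD.isOpen_compl
      have hkI : |(ψ (k I)).im| ≤ r / 16 := by
        have h3 := him (k I) (α I (t I))
        rw [ht I hI, abs_zero, zero_add] at h3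
        have h4 : k I ∈ insert (α I (t I)) (Dᶜ ∩ Metric.closedBall (α I (t I)) (r / 16)) :=
          (hjoin I hI).target_mem
        rcases h4 with h4 | h4
        · rw [h4, ht I hI, abs_zero]; linarith
        · linarith [Metric.mem_closedBall.1 h4.2]
      have hWO : W (i I) ⊆ O := by
        intro x hx
        refine ⟨?_, disjoint_left.1 hKD (hWK _ hx)⟩
        have := hWd _ x hx _ (hki I hI)
        rw [mem_ofPred_eq]
        linarith [him x (k I)]
      have hsub := (hWc (i I)).subset_connectedComponentIn (hki I hI) hWO
      have hpc : IsPathConnected (connectedComponentIn O (k I)) :=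
        hOo.connectedComponentIn.isConnected_iff_isPathConnected.1
          (isConnected_connectedComponentIn_iff.2 (hWO (hki I hI)))
      refine (hpc.joinedIn _ (hsub (hki I hI)) _ (hsub (hil ▸ hki L hL))).mono ?_
      refine (connectedComponentIn_subset _ _).trans ?_
      rintro x ⟨hx1, hx2⟩
      rw [mem_ofPred_eq] at hx1
      refine ⟨hx1.le, ?_⟩
      rintro ⟨d, rfl⟩
      exact hx2 (hαD J hJ d)
    have hall : JoinedIn Y (α I 0) (α L 0) :=
      (((harc I hI hIJ 0 (t I)).trans (hball I hI hIJ)).trans hmid).trans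
        ((hball L hL hLJ).symm.trans (harc L hL hLJ (t L) 0))
    obtain ⟨γ, hγ⟩ := hall
    have hγe : ∀ a, γ.extend a ∈ Y := fun a => by
      obtain ⟨b, hb⟩ : γ.extend a ∈ range γ := γ.extend_range ▸ mem_range_self a
      exact hb ▸ hγ b
    obtain ⟨a, b, hab⟩ := curves_meet (P := fun a => ψ (γ.extend a)) (A := fun b => ψ (α J b))
      (c := -(r / 4)) (ψ.continuous.comp γ.continuous_extend) (ψ.continuous.comp (hαc J hJ))
      (by simp [hα0 I hI]) (by simp [hα0 L hL]) (hα0 J hJ) (by simpa using h1)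
      (by simpa using h2) (fun a => (abs_le.1 (hγe a).1).1) (fun b => (abs_le.1 (hαs J hJ b)).1)
      (fun a => by simp only [hα1 J hJ]; exact (abs_le.1 (hγe a).1).2)
    exact (hγe a).2 ⟨b, (ψ.injective hab).symm⟩
  have hreinj : ∀ I ∈ crossings r ℓ u, ∀ J ∈ crossings r ℓ u, I ≠ J →
      (ψ (α I 0)).re ≠ (ψ (α J 0)).re := fun I hI J hJ hne h =>
    hdisj I hI J hJ hne 0 0 (ψ.injective (Complex.ext h (by rw [hα0 I hI, hα0 J hJ])))
  by_contra! hcard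
  obtain ⟨T, hT, hTcard⟩ := Set.exists_subset_encard_eq (Order.add_one_le_of_lt hcard)
  have hTfin : T.Finite := Set.finite_of_encard_eq_coe (k := 2 * s.card + 1) (by rw [hTcard]; norm_cast)
  lift T to Finset (Set Circle) using hTfin
  rw [Set.encard_coe_eq_coe_finsetCard] at hTcard
  have hTcard : T.card = 2 * s.card + 1 := by exact_mod_cast hTcard
  -- With `2 * s.card + 1` crossings, three share a piece of the cover. Ordering their starting
  -- points singles out the middle one.
  obtain ⟨i₀, hi₀, hfib⟩ := Finset.exists_lt_card_fiber_of_mul_lt_card_of_maps_to (s := T) (t := s)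
    (f := i) (n := 2) (fun I hI => his I (hT hI)) (by omega)
  obtain ⟨I, hI, J, hJ, L, hL, hIJ, hIL, hJL⟩ := Finset.two_lt_card.1 hfib
  rw [Finset.mem_filter] at hI hJ hL
  have eI := hT hI.1
  have eJ := hT hJ.1
  have eL := hT hL.1
  rcases lt_or_gt_of_ne (hreinj I eI J eJ hIJ) with h1 | h1 <;>
  rcases lt_or_gt_of_ne (hreinj I eI L eL hIL) with h2 | h2 <;>
  rcases lt_or_gt_of_ne (hreinj J eJ L eL hJL) with h3 | h3
  · exact hbetween I eI J eJ L eL hIJ hJL.symm (hI.2.trans hL.2.symm) h1 h3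
  · exact hbetween I eI L eL J eJ hIL hJL (hI.2.trans hJ.2.symm) h2 h3
  · linarith
  · exact hbetween L eL I eI J eJ hIL.symm hIJ.symm (hL.2.trans hJ.2.symm) h2 h1
  · exact hbetween J eJ I eI L eL hIJ.symm hIL.symm (hJ.2.trans hL.2.symm) h1 h2
  · linarith
  · exact hbetween J eJ L eL I eI hJL hIL (hJ.2.trans hI.2.symm) h3 h2
  · exact hbetween L eL J eJ I eI hJL.symm hIJ (hL.2.trans hI.2.symm) h3 h1

/-! ### Connectedness in the triangular lattice -/

/-- The six steps of the triangular lattice `ℤ × ℤ`, in cyclic order. -/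
def hexStep : Fin 6 → ℤ × ℤ := ![(1, 0), (0, 1), (-1, 1), (-1, 0), (0, -1), (1, -1)]

theorem hexStep_add_two (d : Fin 6) : hexStep d + hexStep (d + 2) = hexStep (d + 1) := by
  revert d; decide

theorem hexStep_add_three (d : Fin 6) : hexStep (d + 3) = -hexStep d := by
  revert d; decide

theorem hexStep_injective : Function.Injective hexStep := by decide

/-- A set of lattice points that cannot be split into two parts without a step between them. -/
def IsHexConnected (S : Set (ℤ × ℤ)) : Prop :=
  ∀ A : Set (ℤ × ℤ), (S ∩ A).Nonempty →
    (∀ a ∈ S ∩ A, ∀ d, a + hexStep d ∈ S → a + hexStep d ∈ A) → S ⊆ A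

theorem isHexConnected_univ : IsHexConnected univ := by
  rintro A ⟨⟨i₀, j₀⟩, -, h0⟩ hA ⟨i, j⟩ -
  have step : ∀ a ∈ A, ∀ d, a + hexStep d ∈ A := fun a ha d =>
    hA a ⟨mem_univ _, ha⟩ d (mem_univ _)
  have h1 : (i, j₀) ∈ A := by
    induction i using Int.inductionOn' (b := i₀) with
    | zero => exact h0
    | succ k _ ih => simpa [hexStep] using step _ ih 0
    | pred k _ ih => simpa [hexStep, sub_eq_add_neg] using step _ ih 3
  induction j using Int.inductionOn' (b := j₀) with
  | zero => exact h1
  | succ k _ ih => simpa [hexStep] using step _ ih 1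
  | pred k _ ih => simpa [hexStep, sub_eq_add_neg] using step _ ih 4

/-- The part of `S` that can be reached from `a` by steps within `S`. -/
def hexComponent (S : Set (ℤ × ℤ)) (a : ℤ × ℤ) : Set (ℤ × ℤ) :=
  {b | ∀ A : Set (ℤ × ℤ), a ∈ A → (∀ x ∈ A, ∀ d, x + hexStep d ∈ S → x + hexStep d ∈ A) → b ∈ A}

theorem mem_hexComponent_self (S : Set (ℤ × ℤ)) (a : ℤ × ℤ) : a ∈ hexComponent S a :=
  fun _ h _ => h

theorem hexComponent_subset {S : Set (ℤ × ℤ)} {a : ℤ × ℤ} (ha : a ∈ S) : hexComponent S a ⊆ S :=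
  fun _ hb => hb S ha fun _ _ _ h => h

theorem add_mem_hexComponent {S : Set (ℤ × ℤ)} {a b : ℤ × ℤ} (hb : b ∈ hexComponent S a)
    {d : Fin 6} (h : b + hexStep d ∈ S) : b + hexStep d ∈ hexComponent S a :=
  fun A ha hA => hA b (hb A ha hA) d h

theorem add_hexStep_add_three (a : ℤ × ℤ) (d : Fin 6) : a + hexStep d + hexStep (d + 3) = a := by
  rw [hexStep_add_three, add_neg_cancel_right]

theorem isHexConnected_hexComponent (S : Set (ℤ × ℤ)) (a : ℤ × ℤ) :
    IsHexConnected (hexComponent S a) := by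
  rintro A ⟨x, hxC, hxA⟩ hA
  have haA : a ∈ A := by
    by_contra haA
    -- Since steps are reversible, the part outside `A` is also closed under steps; containing `a`,
    -- it would be the whole component.
    refine (hxC (hexComponent S a \ A) ⟨mem_hexComponent_self S a, haA⟩ ?_).2 hxA
    rintro y ⟨hyC, hyA⟩ d hd
    refine ⟨add_mem_hexComponent hyC hd, fun hdA => hyA ?_⟩
    have := hA (y + hexStep d) ⟨add_mem_hexComponent hyC hd, hdA⟩ (d + 3)
    rw [add_hexStep_add_three] at this
    exact this hyC
  intro b hb
  refine (hb (hexComponent S a ∩ A) ⟨mem_hexComponent_self S a, haA⟩ ?_).2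
  rintro y hy d hd
  exact ⟨add_mem_hexComponent hy.1 hd, hA y hy d (add_mem_hexComponent hy.1 hd)⟩

/-- Two components with a common point agree. -/
theorem hexComponent_eq_of_mem {S : Set (ℤ × ℤ)} {a b : ℤ × ℤ} (ha : a ∈ S)
    (hb : b ∈ hexComponent S a) : hexComponent S b = hexComponent S a := by
  have hbS := hexComponent_subset ha hb
  refine Subset.antisymm (fun c hc => hc _ hb fun x hx d hd => add_mem_hexComponent hx hd) ?_
  exact isHexConnected_hexComponent S a _ ⟨b, hb, mem_hexComponent_self S b⟩
    fun x hx d hd => add_mem_hexComponent hx.2 (hexComponent_subset ha hd)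

/-- The complement of a complementary component of a connected set is connected. -/
theorem isHexConnected_compl_hexComponent {E : Set (ℤ × ℤ)} (hE : IsHexConnected E)
    (hne : E.Nonempty) {a : ℤ × ℤ} (ha : a ∉ E) : IsHexConnected (hexComponent Eᶜ a)ᶜ := by
  set C := hexComponent Eᶜ a with hC
  have hCE : C ⊆ Eᶜ := hexComponent_subset ha
  -- A nonempty step-closed part of `Cᶜ` that misses `E` would be closed under all lattice steps,
  -- since a point outside `E` next to `C` belongs to `C`. It would then be the whole lattice. So
  -- every such part contains `E`, and two disjoint ones cannot coexist.
  have key : ∀ A : Set (ℤ × ℤ), (Cᶜ ∩ A).Nonempty →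
      (∀ a ∈ Cᶜ ∩ A, ∀ d, a + hexStep d ∈ Cᶜ → a + hexStep d ∈ A) → E ⊆ A := by
    intro A hAne hA
    by_cases hEA : (E ∩ A).Nonempty
    · exact hE A hEA fun x hx d hd => hA x ⟨fun h => hCE h hx.1, hx.2⟩ d fun h => hCE h hd
    exfalso
    rw [not_nonempty_iff_eq_empty] at hEA
    obtain ⟨x, hx⟩ := hAne
    have huniv := isHexConnected_univ (Cᶜ ∩ A) ⟨x, mem_univ x, hx⟩ (by
      rintro y ⟨-, hyC, hyA⟩ d -
      have hyE : y ∉ E := fun h => (eq_empty_iff_forall_notMem.1 hEA) y ⟨h, hyA⟩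
      have hdC : y + hexStep d ∈ Cᶜ := by
        intro h
        have := add_mem_hexComponent h (d := d + 3)
        rw [add_hexStep_add_three] at this
        exact hyC (this hyE)
      exact ⟨hdC, hA y ⟨hyC, hyA⟩ d hdC⟩)
    obtain ⟨e, he⟩ := hne
    exact (eq_empty_iff_forall_notMem.1 hEA) e ⟨he, (huniv (mem_univ e)).2⟩
  intro A hAne hA x hx
  by_contra hxA
  obtain ⟨e, he⟩ := hne
  refine key Aᶜ ⟨x, hx, hxA⟩ ?_ he (key A hAne hA he)
  rintro y ⟨hyC, hyA⟩ d hd hdA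
  have := hA _ ⟨hd, hdA⟩ (d + 3)
  rw [add_hexStep_add_three] at this
  exact hyA (this hyC)

/-! ### The boundary walk of a lattice set -/

/-- The directed lattice edges `(a, d)` that leave `S`. -/
def boundaryDarts (S : Set (ℤ × ℤ)) : Set ((ℤ × ℤ) × Fin 6) :=
  {p | p.1 ∈ S ∧ p.1 + hexStep p.2 ∉ S}

open Classical in
/-- The next edge that leaves `S`, when its boundary is traversed with `S` on the left. -/
noncomputable def nextDart (S : Set (ℤ × ℤ)) (p : (ℤ × ℤ) × Fin 6) : (ℤ × ℤ) × Fin 6 :=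
  if p.1 + hexStep (p.2 + 1) ∈ S then (p.1 + hexStep (p.2 + 1), p.2 - 1) else (p.1, p.2 + 1)

/-- When the walk moves its tail to the third vertex of the triangle, the head stays where it is. -/
theorem hexStep_add_one_add_sub_one (a : ℤ × ℤ) (d : Fin 6) :
    a + hexStep (d + 1) + hexStep (d - 1) = a + hexStep d := by
  rw [add_assoc]; congr 1; revert d; decide

theorem nextDart_mem {S : Set (ℤ × ℤ)} {p : (ℤ × ℤ) × Fin 6} (hp : p ∈ boundaryDarts S) :
    nextDart S p ∈ boundaryDarts S := by
  unfold nextDart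
  split_ifs with h
  · refine ⟨h, ?_⟩
    simp only [hexStep_add_one_add_sub_one]
    exact hp.2
  · exact ⟨hp.1, h⟩

theorem nextDart_injOn (S : Set (ℤ × ℤ)) : InjOn (nextDart S) (boundaryDarts S) := by
  -- If the two rules gave the same dart, the head of `(a', d')` would be `a`, a point of `S`.
  have mixed : ∀ a a' d d', a ∈ S → a' + hexStep d' ∉ S →
      ((a + hexStep (d + 1), d - 1) : (ℤ × ℤ) × Fin 6) = (a', d' + 1) → False := by
    intro a a' d d' ha ha' h
    obtain ⟨rfl, h2⟩ := Prod.mk.inj h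
    have hd' : d' = d + 1 + 3 := by omega
    rw [hd', add_hexStep_add_three] at ha'
    exact ha' ha
  rintro ⟨a, d⟩ ⟨ha, hd⟩ ⟨a', d'⟩ ⟨ha', hd'⟩ h
  unfold nextDart at h
  simp only at h ha ha' hd hd'
  split_ifs at h
  · obtain ⟨h1, h2⟩ := Prod.mk.inj h
    obtain rfl := sub_left_injective h2
    rw [add_right_cancel h1]
  · exact (mixed a a' d d' ha hd' h).elim
  · exact (mixed a' a d' d ha' hd h.symm).elim
  · obtain ⟨rfl, h2⟩ := Prod.mk.inj h
    rw [add_right_cancel h2]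

theorem exists_int_primitive (g : ℤ → ZMod 2) : ∃ G : ℤ → ZMod 2, ∀ k, G (k + 1) = G k + g k := by
  refine ⟨fun k => Int.casesOn k (fun n => ∑ i ∈ Finset.range n, g i)
    fun n => -∑ i ∈ Finset.range (n + 1), g (-(i + 1)), fun k => ?_⟩
  rcases k with n | n
  · exact Finset.sum_range_succ (fun i : ℕ => g i) n
  · rcases n with _ | n
    · change 0 = -∑ i ∈ Finset.range 1, g (-(i + 1)) + g (-1)
      simp [CharTwo.add_self_eq_zero]
    · change -∑ i ∈ Finset.range (n + 1), g (-(i + 1)) =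
        -∑ i ∈ Finset.range (n + 1 + 1), g (-(i + 1)) + g (Int.negSucc (n + 1))
      rw [Finset.sum_range_succ _ (n + 1), Int.negSucc_eq]
      ring

/-- A symmetric mod-2 function on the edges of the triangular lattice whose sum over each triangle
vanishes is the difference of a function on the vertices. -/
theorem exists_hex_primitive (h : ℤ × ℤ → Fin 6 → ZMod 2)
    (hsymm : ∀ a d, h (a + hexStep d) (d + 3) = h a d)
    (htri : ∀ a d, h a d + h (a + hexStep d) (d + 2) + h (a + hexStep (d + 1)) (d + 4) = 0) :
    ∃ F : ℤ × ℤ → ZMod 2, ∀ a d, F (a + hexStep d) = F a + h a d := by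
  obtain ⟨G, hG⟩ := exists_int_primitive fun j => h (0, j) 1
  -- Discrete Poincaré lemma: integrate up the column `i = 0`, then along each row. The two
  -- triangles of a unit square share a diagonal that cancels mod 2, which gives compatibility
  -- between adjacent rows.
  have hrow : ∀ j : ℤ, ∃ H : ℤ → ZMod 2, H 0 = G j ∧ ∀ i, H (i + 1) = H i + h (i, j) 0 := by
    intro j
    obtain ⟨H, hH⟩ := exists_int_primitive fun i => h (i, j) 0
    refine ⟨fun i => H i - H 0 + G j, by ring, fun i => ?_⟩
    simp only [hH]; ring
  choose H hH0 hH using hrow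
  have d0 : ∀ i j, H j (i + 1) = H j i + h (i, j) 0 := fun i j => hH j i
  have s1 : ∀ i j, h (i, j + 1) 4 = h (i, j) 1 := fun i j => by
    simpa [hexStep] using hsymm (i, j) 1
  have s0 : ∀ i j, h (i + 1, j) 3 = h (i, j) 0 := fun i j => by
    simpa [hexStep] using hsymm (i, j) 0
  have s2 : ∀ i j, h (i, j + 1) 5 = h (i + 1, j) 2 := fun i j => by
    simpa [hexStep] using hsymm (i + 1, j) 2
  have t0 : ∀ i j, h (i, j) 0 + h (i + 1, j) 2 + h (i, j) 1 = 0 := fun i j => by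
    rw [← s1]; simpa [hexStep] using htri (i, j) 0
  have t1 : ∀ i j, h (i + 1, j) 1 + h (i, j + 1) 0 + h (i + 1, j) 2 = 0 := fun i j => by
    rw [← s0, ← s2]; simpa [hexStep] using htri (i + 1, j) 1
  have square : ∀ i j, h (i, j) 0 + h (i + 1, j) 1 = h (i, j) 1 + h (i, j + 1) 0 := by
    intro i j
    have e1 := t0 i j
    have e2 := t1 i j
    generalize h (i, j) 0 = x1 at *
    generalize h (i + 1, j) 2 = x2 at *
    generalize h (i, j) 1 = x3 at *
    generalize h (i + 1, j) 1 = x4 at *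
    generalize h (i, j + 1) 0 = x5 at *
    clear * - e1 e2
    revert x1 x2 x3 x4 x5
    decide
  have d1 : ∀ i j, H (j + 1) i = H j i + h (i, j) 1 := by
    intro i j
    induction i using Int.induction_on with
    | zero => rw [hH0, hH0, hG]
    | succ k ih => rw [d0, d0, ih]; linear_combination - square k j
    | pred k ih =>
      have e1 := d0 (-k - 1) j
      have e2 := d0 (-k - 1) (j + 1)
      have e3 := square (-k - 1) j
      rw [sub_add_cancel] at e1 e2 e3
      linear_combination ih + e1 - e2 + e3
  have d2 : ∀ i j, H (j + 1) i = H j (i + 1) + h (i + 1, j) 2 := by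
    intro i j
    have e1 := t0 i j
    rw [d1, d0]
    generalize h (i, j) 0 = x1 at *
    generalize h (i + 1, j) 2 = x2 at *
    generalize h (i, j) 1 = x3 at *
    generalize H j i = x4
    clear * - e1
    revert x1 x2 x3 x4
    decide
  have dpos : ∀ a, ∀ d : Fin 6, d < 3 →
      H (a + hexStep d).2 (a + hexStep d).1 = H a.2 a.1 + h a d := by
    rintro ⟨i, j⟩ d hd
    obtain rfl | rfl | rfl : d = 0 ∨ d = 1 ∨ d = 2 := by omega
    · simpa [hexStep] using d0 i j
    · simpa [hexStep] using d1 i j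
    · simpa [hexStep, sub_eq_add_neg] using d2 (i - 1) j
  refine ⟨fun a => H a.2 a.1, fun a d => ?_⟩
  by_cases hd : d < 3
  · exact dpos a d hd
  · have e1 := dpos (a + hexStep d) (d + 3) (by omega)
    rw [add_hexStep_add_three, hsymm] at e1
    simp only
    rw [e1, add_assoc, CharTwo.add_self_eq_zero, add_zero]

/-- If `S` and its complement are connected, then a set of edges leaving `S` that is closed under
traversal of the boundary contains all edges leaving `S`. -/
theorem boundaryDarts_subset_of_nextDart {S : Set (ℤ × ℤ)} (hS : IsHexConnected S)
    (hSc : IsHexConnected Sᶜ) {O : Set ((ℤ × ℤ) × Fin 6)} (hO : O ⊆ boundaryDarts S)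
    (hne : O.Nonempty) (hnext : ∀ p ∈ boundaryDarts S, nextDart S p ∈ O ↔ p ∈ O) :
    boundaryDarts S ⊆ O := by
  classical
  -- `h` counts mod 2 whether an edge is crossed by the walk `O`. A primitive of `h` serves as the
  -- parity of a winding number, as in the Jordan curve theorem.
  set h : ℤ × ℤ → Fin 6 → ZMod 2 := fun a d =>
    if (a, d) ∈ O ∨ (a + hexStep d, d + 3) ∈ O then 1 else 0 with hdef
  have d33 : ∀ d : Fin 6, d + 3 + 3 = d := by decide
  have hsymm : ∀ a d, h (a + hexStep d) (d + 3) = h a d := by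
    intro a d
    simp only [hdef, add_hexStep_add_three, d33, or_comm]
  have notS : ∀ a d, a ∉ S → (a, d) ∉ O := fun a d ha h => ha (hO h).1
  have inS : ∀ a d, a + hexStep d ∈ S → (a, d) ∉ O := fun a d ha h => (hO h).2 ha
  have same : ∀ a d, (a ∈ S ↔ a + hexStep d ∈ S) → h a d = 0 := by
    intro a d had
    simp only [hdef]
    rw [if_neg]
    by_cases ha : a ∈ S
    · rintro (h | h)
      · exact inS a d (had.1 ha) h
      · exact inS _ _ (by rwa [add_hexStep_add_three]) h
    · rintro (h | h)
      · exact notS a d ha h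
      · exact notS _ _ (fun h' => ha (had.2 h')) h
  have tri1 : ∀ a d, a + hexStep d + hexStep (d + 2) = a + hexStep (d + 1) := by
    intro a d; rw [add_assoc, hexStep_add_two]
  have tri2 : ∀ a d, a + hexStep (d + 1) + hexStep (d + 4) = a := by
    intro a d
    rw [show d + 4 = d + 1 + 3 by omega, add_hexStep_add_three]
  have tri3 : ∀ a d, a + hexStep d + hexStep (d + 3) = a := add_hexStep_add_three
  -- In a mixed triangle exactly two sides join `S` to its complement. They are a dart and its
  -- `nextDart`, hence both in `O` or both outside it.
  have leave : ∀ a d, a ∈ S → a + hexStep d ∉ S →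
      h a d + h (a + hexStep d) (d + 2) + h (a + hexStep (d + 1)) (d + 4) = 0 := by
    intro a d ha hb
    have hp : (a, d) ∈ boundaryDarts S := ⟨ha, hb⟩
    have h1 : h a d = if (a, d) ∈ O then 1 else 0 := by
      simp only [hdef, notS _ _ hb, or_false]
    have hn := hnext _ hp
    by_cases hc : a + hexStep (d + 1) ∈ S
    · have h3 : h (a + hexStep (d + 1)) (d + 4) = 0 := same _ _ (by rw [tri2]; exact ⟨fun _ => ha, fun _ => hc⟩)
      have h2 : h (a + hexStep d) (d + 2) = if (a + hexStep (d + 1), d - 1) ∈ O then 1 else 0 := by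
        simp only [hdef, notS _ _ hb, tri1, false_or,
          show d + 2 + 3 = d - 1 by omega]
      rw [nextDart, if_pos hc] at hn
      simp only [hn] at h2
      rw [h1, h2, h3, add_zero, CharTwo.add_self_eq_zero]
    · have h2 : h (a + hexStep d) (d + 2) = 0 := same _ _ (by rw [tri1]; simp [hb, hc])
      have h3 : h (a + hexStep (d + 1)) (d + 4) = if (a, d + 1) ∈ O then 1 else 0 := by
        simp only [hdef, notS _ _ hc, tri2, false_or,
          show d + 4 + 3 = d + 1 by omega]
      rw [nextDart, if_neg hc] at hn
      simp only [hn] at h3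
      rw [h1, h2, h3, add_zero, CharTwo.add_self_eq_zero]
  have rot : ∀ a d, h (a + hexStep d) (d + 2) + h (a + hexStep d + hexStep (d + 2)) (d + 2 + 2) +
      h (a + hexStep d + hexStep (d + 2 + 1)) (d + 2 + 4) =
      h a d + h (a + hexStep d) (d + 2) + h (a + hexStep (d + 1)) (d + 4) := by
    intro a d
    rw [tri1, show d + 2 + 1 = d + 3 by omega, tri3,
      show d + 2 + 2 = d + 4 by omega, show d + 2 + 4 = d by omega]
    ring
  have htri : ∀ a d, h a d + h (a + hexStep d) (d + 2) + h (a + hexStep (d + 1)) (d + 4) = 0 := by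
    intro a d
    by_cases h1 : a ∈ S ∧ a + hexStep d ∉ S
    · exact leave a d h1.1 h1.2
    by_cases h2 : a + hexStep d ∈ S ∧ a + hexStep (d + 1) ∉ S
    · rw [← rot]
      exact leave _ _ h2.1 (by rw [tri1]; exact h2.2)
    by_cases h3 : a + hexStep (d + 1) ∈ S ∧ a ∉ S
    · rw [← rot, ← rot]
      refine leave _ _ (by rw [tri1]; exact h3.1) ?_
      rw [show d + 2 + 2 = d + 4 by omega, tri1, tri2]
      exact h3.2
    rw [same a d (by tauto), same _ _ (by rw [tri1]; tauto), same _ _ (by rw [tri2]; tauto)]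
    rfl
  obtain ⟨F, hF⟩ := exists_hex_primitive h hsymm htri
  obtain ⟨⟨a₀, d₀⟩, h0⟩ := hne
  have ha₀ := (hO h0).1
  have hb₀ := (hO h0).2
  simp only at ha₀ hb₀
  have hFb : F (a₀ + hexStep d₀) = F a₀ + 1 := by
    rw [hF]
    simp only [hdef, h0, true_or, if_true]
  -- The primitive is constant on `S` and on `Sᶜ` by connectedness. The two values differ across one
  -- edge of `O`, so they differ across every edge leaving `S`, which puts all these edges in `O`.
  have hFS : S ⊆ {b | F b = F a₀} := by
    refine hS _ ⟨a₀, ha₀, rfl⟩ ?_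
    rintro b ⟨hb, hbF⟩ d hd
    change F _ = _
    rw [hF, same b d ⟨fun _ => hd, fun _ => hb⟩, add_zero]
    exact hbF
  have hFSc : Sᶜ ⊆ {b | F b = F a₀ + 1} := by
    refine hSc _ ⟨_, hb₀, hFb⟩ ?_
    rintro b ⟨hb, hbF⟩ d hd
    change F _ = _
    rw [hF, same b d ⟨fun h => absurd h hb, fun h => absurd h hd⟩, add_zero]
    exact hbF
  rintro ⟨a, d⟩ ⟨ha, hb⟩
  have e1 : F a = F a₀ := hFS ha
  have e2 : F (a + hexStep d) = F a₀ + 1 := hFSc hb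
  rw [hF, e1, add_right_inj] at e2
  by_contra hcon
  have : h a d = 0 := by
    simp only [hdef]
    rw [if_neg]
    rintro (h | h)
    · exact hcon h
    · exact notS _ _ hb h
  rw [this] at e2
  exact absurd e2 (by decide)

theorem hexStep_ne_zero (d : Fin 6) : hexStep d ≠ 0 := by
  revert d; decide

theorem hexStep_add_one_ne (d : Fin 6) : hexStep (d + 1) ≠ hexStep d := by
  revert d; decide

/-! ### Hat functions and piecewise affine interpolation -/

/-- The norm on the plane whose unit ball is the hexagon spanned by the steps `hexStep`. -/
noncomputable def hexNorm (u v : ℝ) : ℝ := max (max |u| |v|) |u + v|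

/-- The map `(u, v) ↦ (u + v, -u)` sends `hexStep (d + 1)` to `hexStep d`; iterating it reduces
every triangle to the one with `d = 0`. -/
theorem hexNorm_rotate (u v : ℝ) : hexNorm (u + v) (-u) = hexNorm u v := by
  unfold hexNorm
  rw [abs_neg, show u + v + -u = v by ring, max_comm |u + v|, max_assoc, max_assoc, max_comm |v|]

/-- The continuous function that is affine on the triangles of the lattice of mesh `ε`, is `1` at
the lattice point `a` and vanishes at all others. -/
noncomputable def hat (ε : ℝ) (a : ℤ × ℤ) (x : Plane) : ℝ :=
  max 0 (1 - hexNorm (x 0 / ε - a.1) (x 1 / ε - a.2))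

/-- The point with barycentric coordinates `(1 - s - t, s, t)` in the lattice triangle with
vertices `a`, `a + hexStep d` and `a + hexStep (d + 1)`. -/
noncomputable def triPt (ε : ℝ) (a : ℤ × ℤ) (d : Fin 6) (s t : ℝ) : Plane :=
  !₂[ε * (a.1 + s * (hexStep d).1 + t * (hexStep (d + 1)).1),
    ε * (a.2 + s * (hexStep d).2 + t * (hexStep (d + 1)).2)]

/-- The lattice point `a` of the lattice of mesh `ε`. -/
noncomputable def latticePt (ε : ℝ) (a : ℤ × ℤ) : Plane := !₂[ε * a.1, ε * a.2]

theorem triPt_zero_zero (ε : ℝ) (a : ℤ × ℤ) (d : Fin 6) : triPt ε a d 0 0 = latticePt ε a := by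
  simp [triPt, latticePt]

theorem hat_nonneg (ε : ℝ) (a : ℤ × ℤ) (x : Plane) : 0 ≤ hat ε a x := le_max_left _ _

theorem continuous_hat (ε : ℝ) (a : ℤ × ℤ) : Continuous (hat ε a) := by
  unfold hat hexNorm
  fun_prop

theorem hat_pos_iff {ε : ℝ} {a : ℤ × ℤ} {x : Plane} :
    0 < hat ε a x ↔ |x 0 / ε - a.1| < 1 ∧ |x 1 / ε - a.2| < 1 ∧
      |x 0 / ε - a.1 + (x 1 / ε - a.2)| < 1 := by
  simp [hat, hexNorm, and_assoc]

theorem dist_latticePt_le {ε : ℝ} (hε : 0 < ε) {a : ℤ × ℤ} {x : Plane} (h : 0 < hat ε a x) :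
    dist x (latticePt ε a) ≤ 2 * ε := by
  obtain ⟨h0, h1, -⟩ := hat_pos_iff.1 h
  have key : ∀ y n : ℝ, |y / ε - n| < 1 → |y - ε * n| ≤ ε := by
    intro y n h
    have : y - ε * n = ε * (y / ε - n) := by field_simp
    rw [this, abs_mul, abs_of_pos hε]
    nlinarith
  rw [EuclideanSpace.dist_eq, Fin.sum_univ_two]
  apply Real.sqrt_le_iff.2 ⟨by linarith, ?_⟩
  simp only [latticePt, Real.dist_eq, sq_abs]
  have k0 := key _ _ h0
  have k1 := key _ _ h1
  rw [abs_le] at k0 k1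
  simp
  nlinarith

theorem one_sub_hexNorm_of_up {s t : ℝ} (hs : 0 ≤ s) (ht : 0 ≤ t) (hst : s + t ≤ 1) (m n : ℤ) :
    max 0 (1 - hexNorm (s - m) (t - n)) =
      if m = 0 ∧ n = 0 then 1 - s - t else if m = 1 ∧ n = 0 then s
        else if m = 0 ∧ n = 1 then t else 0 := by
  unfold hexNorm
  split_ifs with h1 h2 h3
  · obtain ⟨rfl, rfl⟩ := h1
    push_cast
    rw [sub_zero, sub_zero, abs_of_nonneg hs, abs_of_nonneg ht, abs_of_nonneg (add_nonneg hs ht),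
      max_eq_right (max_le (by linarith) (by linarith)), max_eq_right (by linarith)]
    ring
  · obtain ⟨rfl, rfl⟩ := h2
    push_cast
    rw [sub_zero, abs_of_nonpos (by linarith : s - 1 ≤ 0), abs_of_nonneg ht,
      abs_of_nonpos (by linarith : s - 1 + t ≤ 0), max_eq_left (le_max_of_le_left (by linarith)),
      max_eq_left (by linarith : t ≤ -(s - 1)), max_eq_right (by linarith)]
    ring
  · obtain ⟨rfl, rfl⟩ := h3
    push_cast
    rw [sub_zero, abs_of_nonpos (by linarith : t - 1 ≤ 0), abs_of_nonneg hs,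
      abs_of_nonpos (by linarith : s + (t - 1) ≤ 0), max_eq_left (le_max_of_le_right (by linarith)),
      max_eq_right (by linarith : s ≤ -(t - 1)), max_eq_right (by linarith)]
    ring
  · apply max_eq_left
    rw [sub_nonpos]
    by_contra! h
    rw [max_lt_iff, max_lt_iff, abs_lt, abs_lt, abs_lt] at h
    obtain ⟨⟨⟨h4, h5⟩, h6, h7⟩, h8, h9⟩ := h
    -- A positive hat value leaves only `m, n ∈ {0, 1}` with `m + n < 2`, the three vertices already
    -- treated.
    have m0 : (-1 : ℝ) < m := by linarith
    have m1 : (m : ℝ) < 2 := by linarith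
    have n0 : (-1 : ℝ) < n := by linarith
    have n1 : (n : ℝ) < 2 := by linarith
    have mn : (m : ℝ) + n < 2 := by linarith
    norm_cast at m0 m1 n0 n1 mn
    omega

theorem div_smul_coord {ε : ℝ} (hε : 0 < ε) (y : ℝ) : ε * y / ε = y := by
  field_simp

/-- The values of the hat functions are the barycentric coordinates. -/
theorem hat_triPt {ε : ℝ} (hε : 0 < ε) (a : ℤ × ℤ) (d : Fin 6) {s t : ℝ} (hs : 0 ≤ s)
    (ht : 0 ≤ t) (hst : s + t ≤ 1) (b : ℤ × ℤ) : hat ε b (triPt ε a d s t) =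
      if b = a then 1 - s - t else if b = a + hexStep d then s
        else if b = a + hexStep (d + 1) then t else 0 := by
  obtain ⟨⟨m, n⟩, rfl⟩ : ∃ c, b = a + c := ⟨b - a, by abel⟩
  have h0 : triPt ε a d s t 0 = ε * (a.1 + s * (hexStep d).1 + t * (hexStep (d + 1)).1) := rfl
  have h1 : triPt ε a d s t 1 = ε * (a.2 + s * (hexStep d).2 + t * (hexStep (d + 1)).2) := rfl
  have main : ∀ m' n' : ℤ,
      hexNorm (s * (hexStep d).1 + t * (hexStep (d + 1)).1 - m)
        (s * (hexStep d).2 + t * (hexStep (d + 1)).2 - n) = hexNorm (s - m') (t - n') →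
      ((m, n) = (0 : ℤ × ℤ) ↔ m' = 0 ∧ n' = 0) → ((m, n) = hexStep d ↔ m' = 1 ∧ n' = 0) →
      ((m, n) = hexStep (d + 1) ↔ m' = 0 ∧ n' = 1) →
      hat ε (a + (m, n)) (triPt ε a d s t) =
      if a + (m, n) = a then 1 - s - t else if a + (m, n) = a + hexStep d then s
        else if a + (m, n) = a + hexStep (d + 1) then t else 0 := by
    intro m' n' hN c0 c1 c2
    simp only [add_right_inj, add_eq_left, c0, c1, c2]
    rw [← one_sub_hexNorm_of_up hs ht hst, ← hN, hat, h0, h1, div_smul_coord hε,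
      div_smul_coord hε]
    congr 3 <;> push_cast [Prod.fst_add, Prod.snd_add] <;> ring
  fin_cases d
  · refine main m n ?_ ?_ ?_ ?_ <;> simp [hexStep, Prod.ext_iff]
  · refine main (m + n) (-m) ?_ ?_ ?_ ?_
    · rw [← hexNorm_rotate]
      congr 1 <;> simp [hexStep] <;> ring
    all_goals simp [hexStep, Prod.ext_iff]; omega
  · refine main n (-m - n) ?_ ?_ ?_ ?_
    · rw [← hexNorm_rotate, ← hexNorm_rotate]
      congr 1 <;> simp [hexStep] <;> ring
    all_goals simp [hexStep, Prod.ext_iff]; omega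
  · refine main (-m) (-n) ?_ ?_ ?_ ?_
    · rw [← hexNorm_rotate, ← hexNorm_rotate, ← hexNorm_rotate]
      congr 1 <;> simp [hexStep] <;> ring
    all_goals simp [hexStep, Prod.ext_iff]; try omega
  · refine main (-m - n) m ?_ ?_ ?_ ?_
    · rw [← hexNorm_rotate, ← hexNorm_rotate, ← hexNorm_rotate, ← hexNorm_rotate]
      congr 1 <;> simp [hexStep] <;> ring
    all_goals simp [hexStep, Prod.ext_iff]; omega
  · refine main (-n) (m + n) ?_ ?_ ?_ ?_
    · rw [← hexNorm_rotate, ← hexNorm_rotate, ← hexNorm_rotate, ← hexNorm_rotate,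
        ← hexNorm_rotate]
      congr 1 <;> simp [hexStep] <;> ring
    all_goals simp [hexStep, Prod.ext_iff]; omega

/-- Describing the same triangle from its next vertex allows any vertex to serve as base point. -/
theorem triPt_rotate (ε : ℝ) (a : ℤ × ℤ) (d : Fin 6) (s t : ℝ) :
    triPt ε (a + hexStep d) (d + 2) t (1 - s - t) = triPt ε a d s t := by
  have e1 : hexStep (d + 2) = hexStep (d + 1) - hexStep d := by
    rw [← hexStep_add_two]; abel
  have e2 : hexStep (d + 2 + 1) = -hexStep d := by
    rw [← hexStep_add_three]; congr 1; omega
  unfold triPt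
  rw [e1, e2]
  congr 2
  · push_cast [Prod.fst_add, Prod.fst_sub, Prod.fst_neg]; ring
  · congr 1
    push_cast [Prod.snd_add, Prod.snd_sub, Prod.snd_neg]; ring

theorem lineMap_triPt (ε : ℝ) (a : ℤ × ℤ) (d : Fin 6) (s t s' t' τ : ℝ) :
    AffineMap.lineMap (triPt ε a d s t) (triPt ε a d s' t') τ =
      triPt ε a d ((1 - τ) * s + τ * s') ((1 - τ) * t + τ * t') := by
  ext i
  rw [AffineMap.lineMap_apply_module]
  fin_cases i <;> simp [triPt] <;> ring

theorem exists_eq_triPt {ε : ℝ} (hε : 0 < ε) (x : Plane) : ∃ a d s t, 0 ≤ s ∧ 0 ≤ t ∧ s + t ≤ 1 ∧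
    x = triPt ε a d s t := by
  have h0 : x 0 = ε * (x 0 / ε) := by field_simp
  have h1 : x 1 = ε * (x 1 / ε) := by field_simp
  have f0 := Int.floor_add_fract (x 0 / ε)
  have f1 := Int.floor_add_fract (x 1 / ε)
  set s := Int.fract (x 0 / ε)
  set t := Int.fract (x 1 / ε)
  have hs : 0 ≤ s := Int.fract_nonneg _
  have ht : 0 ≤ t := Int.fract_nonneg _
  have hs1 : s < 1 := Int.fract_lt_one _
  have ht1 : t < 1 := Int.fract_lt_one _
  -- The antidiagonal splits a unit cell in two; the upper half is the triangle `d = 1` at the lower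
  -- right corner.
  by_cases hst : s + t ≤ 1
  · refine ⟨(⌊x 0 / ε⌋, ⌊x 1 / ε⌋), 0, s, t, hs, ht, hst, ?_⟩
    ext i
    fin_cases i
    · simp [triPt, hexStep]; rw [f0]; exact h0
    · simp [triPt, hexStep]; rw [f1]; exact h1
  · refine ⟨(⌊x 0 / ε⌋ + 1, ⌊x 1 / ε⌋), 1, s + t - 1, 1 - s, by linarith, by linarith, by linarith, ?_⟩
    ext i
    fin_cases i
    · simp [triPt, hexStep]; rw [← sub_eq_zero]; linear_combination h0 - ε * f0
    · simp [triPt, hexStep]; rw [← sub_eq_zero]; linear_combination h1 - ε * f1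

theorem exists_hat_pos {ε : ℝ} (hε : 0 < ε) (x : Plane) : ∃ a, 0 < hat ε a x := by
  obtain ⟨a, d, s, t, hs, ht, hst, rfl⟩ := exists_eq_triPt hε x
  by_contra! h
  have e0 := h a
  have e1 := h (a + hexStep d)
  have e2 := h (a + hexStep (d + 1))
  have n1 := hexStep_ne_zero d
  have n2 := hexStep_ne_zero (d + 1)
  have n3 := hexStep_add_one_ne d
  rw [hat_triPt hε _ _ hs ht hst] at e0 e1 e2
  simp [n1, n2, n3] at e0 e1 e2
  linarith

/-- A point in the open star of the lattice point `b` lies in a lattice triangle at `b`. -/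
theorem exists_eq_triPt_of_hat_pos {ε : ℝ} (hε : 0 < ε) {x : Plane} {b : ℤ × ℤ}
    (h : 0 < hat ε b x) : ∃ d s t, 0 ≤ s ∧ 0 ≤ t ∧ s + t ≤ 1 ∧ x = triPt ε b d s t := by
  obtain ⟨a, d, s, t, hs, ht, hst, rfl⟩ := exists_eq_triPt hε x
  rw [hat_triPt hε _ _ hs ht hst] at h
  split_ifs at h with h1 h2 h3
  · subst h1; exact ⟨d, s, t, hs, ht, hst, rfl⟩
  · subst h2
    exact ⟨d + 2, t, 1 - s - t, ht, by linarith, by linarith, (triPt_rotate ..).symm⟩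
  · subst h3
    refine ⟨d + 2 + 2, 1 - s - t, s, by linarith, hs, by linarith, ?_⟩
    rw [← triPt_rotate ε a d, ← triPt_rotate ε (a + hexStep d), add_assoc a, hexStep_add_two]
    congr 1
    ring
  · exact absurd h (lt_irrefl _)

/-- Two lattice points with intersecting open stars are equal or adjacent. -/
theorem exists_hexStep_of_hat_pos {ε : ℝ} (hε : 0 < ε) {x : Plane} {a b : ℤ × ℤ}
    (ha : 0 < hat ε a x) (hb : 0 < hat ε b x) (hab : b ≠ a) : ∃ d, b = a + hexStep d := by
  obtain ⟨d, s, t, hs, ht, hst, rfl⟩ := exists_eq_triPt_of_hat_pos hε ha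
  rw [hat_triPt hε _ _ hs ht hst] at hb
  rw [if_neg hab] at hb
  split_ifs at hb with h2 h3
  · exact ⟨_, h2⟩
  · exact ⟨_, h3⟩
  · exact absurd hb (lt_irrefl _)

open Classical in
/-- The piecewise affine interpolation of the indicator function of a set of lattice points. -/
noncomputable def hexInterp (ε : ℝ) (S : Set (ℤ × ℤ)) (x : Plane) : ℝ :=
  ∑ᶠ a, if a ∈ S then hat ε a x else 0

open Classical in
theorem hexInterp_triPt {ε : ℝ} (hε : 0 < ε) (S : Set (ℤ × ℤ)) (a : ℤ × ℤ) (d : Fin 6) {s t : ℝ}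
    (hs : 0 ≤ s) (ht : 0 ≤ t) (hst : s + t ≤ 1) : hexInterp ε S (triPt ε a d s t) =
      (if a ∈ S then 1 - s - t else 0) + (if a + hexStep d ∈ S then s else 0) +
        if a + hexStep (d + 1) ∈ S then t else 0 := by
  have n1 := hexStep_ne_zero d
  have n2 := hexStep_ne_zero (d + 1)
  have n3 := hexStep_add_one_ne d
  unfold hexInterp
  rw [finsum_eq_sum_of_support_subset (s := {a, a + hexStep d, a + hexStep (d + 1)})]
  · rw [Finset.sum_insert (by simp [n1, n2]),
      Finset.sum_insert (by simp [n3.symm]), Finset.sum_singleton]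
    simp only [hat_triPt hε _ _ hs ht hst]
    simp [n1, n2, n3, add_assoc]
  · intro b hb
    rw [Function.mem_support] at hb
    simp only [hat_triPt hε _ _ hs ht hst] at hb
    simp only [Finset.coe_insert, Finset.coe_singleton, mem_insert_iff, mem_singleton_iff]
    by_contra! h
    simp [h.1, h.2.1, h.2.2] at hb

theorem continuous_hexInterp {ε : ℝ} (S : Set (ℤ × ℤ)) : Continuous (hexInterp ε S) := by
  classical
  unfold hexInterp
  refine continuous_finsum (fun a => ?_) fun x => ?_
  · split_ifs
    · exact continuous_hat ε a
    · exact continuous_const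
  refine ⟨{y | |y 0 / ε - x 0 / ε| < 1 ∧ |y 1 / ε - x 1 / ε| < 1}, ?_, ?_⟩
  · refine IsOpen.mem_nhds ?_ (by simp)
    have hc : ∀ i : Fin 2, Continuous fun y : Plane => |y i / ε - x i / ε| := fun i => by fun_prop
    exact (isOpen_lt (hc 0) continuous_const).inter (isOpen_lt (hc 1) continuous_const)
  · refine ((finite_Icc (⌊x 0 / ε⌋ - 3) (⌊x 0 / ε⌋ + 3)).prod
      (finite_Icc (⌊x 1 / ε⌋ - 3) (⌊x 1 / ε⌋ + 3))).subset ?_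
    rintro ⟨m, n⟩ ⟨y, hy, h0, h1⟩
    have hpos : 0 < hat ε (m, n) y := by
      refine lt_of_le_of_ne (hat_nonneg _ _ _) fun h => hy ?_
      simp only [← h, ite_self]
    obtain ⟨h2, h3, -⟩ := hat_pos_iff.1 hpos
    have key : ∀ p q : ℝ, ∀ k : ℤ, |p - q| < 1 → |p - k| < 1 → k ∈ Icc (⌊q⌋ - 3) (⌊q⌋ + 3) := by
      intro p q k h h'
      rw [abs_lt] at h h'
      have f1 := Int.floor_le q
      have f2 := Int.lt_floor_add_one q
      constructor
      · have : (⌊q⌋ : ℝ) - 3 ≤ k := by linarith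
        exact_mod_cast this
      · have : (k : ℝ) ≤ ⌊q⌋ + 3 := by linarith
        exact_mod_cast this
    exact ⟨key _ _ _ h0 h2, key _ _ _ h1 h3⟩

/-- On the segment from a point to a lattice point whose star contains it, the interpolation is
affine. -/
theorem hexInterp_lineMap_latticePt {ε : ℝ} (hε : 0 < ε) (S : Set (ℤ × ℤ)) {x : Plane}
    {b : ℤ × ℤ} (hb : 0 < hat ε b x) {τ : ℝ} (hτ0 : 0 ≤ τ) (hτ1 : τ ≤ 1) :
    hexInterp ε S (AffineMap.lineMap x (latticePt ε b) τ) =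
      (1 - τ) * hexInterp ε S x + τ * S.indicator 1 b := by
  classical
  obtain ⟨d, s, t, hs, ht, hst, rfl⟩ := exists_eq_triPt_of_hat_pos hε hb
  rw [← triPt_zero_zero ε b d, lineMap_triPt, mul_zero, add_zero, add_zero,
    hexInterp_triPt hε S b d hs ht hst, hexInterp_triPt hε S b d (by nlinarith) (by nlinarith)
    (by nlinarith), indicator_apply]
  split_ifs <;> simp <;> ring

theorem hexInterp_eq_one {ε : ℝ} (hε : 0 < ε) {S : Set (ℤ × ℤ)} {x : Plane}
    (h : ∀ a, 0 < hat ε a x → a ∈ S) : hexInterp ε S x = 1 := by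
  classical
  obtain ⟨a, d, s, t, hs, ht, hst, rfl⟩ := exists_eq_triPt hε x
  have n1 := hexStep_ne_zero d
  have n2 := hexStep_ne_zero (d + 1)
  have n3 := hexStep_add_one_ne d
  rw [hexInterp_triPt hε S a d hs ht hst]
  have h0 := h a
  have h1 := h (a + hexStep d)
  have h2 := h (a + hexStep (d + 1))
  rw [hat_triPt hε _ _ hs ht hst] at h0 h1 h2
  simp [n1, n2, n3] at h0 h1 h2
  split_ifs <;> first | ring1 | linarith | skip
  all_goals grind

theorem hexInterp_eq_zero {ε : ℝ} {S : Set (ℤ × ℤ)} {x : Plane}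
    (h : ∀ a, 0 < hat ε a x → a ∉ S) : hexInterp ε S x = 0 := by
  classical
  unfold hexInterp
  rw [finsum_eq_zero_of_forall_eq_zero]
  intro a
  split_ifs with ha
  · by_contra hne
    exact h a (lt_of_le_of_ne (hat_nonneg _ _ _) (Ne.symm hne)) ha
  · rfl

theorem exists_hat_pos_of_hexInterp_pos {ε : ℝ} {S : Set (ℤ × ℤ)} {x : Plane}
    (h : 0 < hexInterp ε S x) : ∃ a ∈ S, 0 < hat ε a x := by
  by_contra! hcon
  rw [hexInterp_eq_zero fun a ha haS => (hcon a haS).not_gt ha] at h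
  exact lt_irrefl _ h

theorem exists_hat_pos_of_hexInterp_lt_one {ε : ℝ} (hε : 0 < ε) {S : Set (ℤ × ℤ)} {x : Plane}
    (h : hexInterp ε S x < 1) : ∃ a ∉ S, 0 < hat ε a x := by
  by_contra! hcon
  rw [hexInterp_eq_one hε fun a ha => by_contra fun haS => (hcon a haS).not_gt ha] at h
  exact lt_irrefl _ h

theorem hat_latticePt {ε : ℝ} (hε : 0 < ε) (a : ℤ × ℤ) : 0 < hat ε a (latticePt ε a) := by
  rw [← triPt_zero_zero ε a 0, hat_triPt hε _ _ le_rfl le_rfl (by norm_num), if_pos rfl]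
  norm_num

theorem hexInterp_latticePt {ε : ℝ} (hε : 0 < ε) (S : Set (ℤ × ℤ)) (a : ℤ × ℤ) :
    hexInterp ε S (latticePt ε a) = S.indicator 1 a := by
  have := hexInterp_lineMap_latticePt hε S (hat_latticePt hε a) zero_le_one le_rfl
  simpa using this

theorem exists_lineMap_mem {U : Set Plane} (hU : IsOpen U) {x : Plane} (hx : x ∈ U) (y : Plane) :
    ∃ τ : ℝ, 0 < τ ∧ τ ≤ 1 ∧ AffineMap.lineMap x y τ ∈ U := by
  have hc : Continuous fun τ : ℝ => (AffineMap.lineMap x y τ : Plane) := AffineMap.lineMap_continuous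
  have h0 : (fun τ : ℝ => (AffineMap.lineMap x y τ : Plane)) ⁻¹' U ∈ nhds (0 : ℝ) :=
    hc.continuousAt.preimage_mem_nhds (by simpa using hU.mem_nhds hx)
  obtain ⟨δ, hδ, hball⟩ := Metric.mem_nhds_iff.1 h0
  refine ⟨min 1 (δ / 2), lt_min one_pos (half_pos hδ), min_le_left _ _, hball ?_⟩
  rw [Metric.mem_ball, Real.dist_eq, sub_zero, abs_of_pos (lt_min one_pos (half_pos hδ))]
  linarith [min_le_right 1 (δ / 2)]

/-! ### Topology of the half-level region -/

/-- The region cut out by a set of lattice points. -/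
def hexRegion (ε : ℝ) (S : Set (ℤ × ℤ)) : Set Plane := {x | 1 / 2 ≤ hexInterp ε S x}

theorem isClosed_hexRegion (ε : ℝ) (S : Set (ℤ × ℤ)) : IsClosed (hexRegion ε S) :=
  isClosed_le continuous_const (continuous_hexInterp S)

/-- A point of value `1 / 2` lies in the star of a lattice point outside `S`. The value falls below
`1 / 2` on the way there, so the point is not interior. Moving towards a lattice point of `S`
instead raises the value, which gives `closure_interior_hexRegion`. -/
theorem interior_hexRegion {ε : ℝ} (hε : 0 < ε) (S : Set (ℤ × ℤ)) :
    interior (hexRegion ε S) = {x | 1 / 2 < hexInterp ε S x} := by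
  refine Subset.antisymm (fun x hx => ?_) (interior_maximal (fun x (hx : 1 / 2 < hexInterp ε S x) => hx.le)
    (isOpen_lt continuous_const (continuous_hexInterp S)))
  have hx1 : 1 / 2 ≤ hexInterp ε S x := (interior_subset hx : x ∈ hexRegion ε S)
  refine lt_of_le_of_ne hx1 fun heq => ?_
  obtain ⟨b, hb, hbx⟩ := exists_hat_pos_of_hexInterp_lt_one hε
    (show hexInterp ε S x < 1 by rw [← heq]; norm_num)
  obtain ⟨τ, h0, h1, hτ⟩ := exists_lineMap_mem isOpen_interior hx (latticePt ε b)
  have : 1 / 2 ≤ hexInterp ε S (AffineMap.lineMap x (latticePt ε b) τ) :=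
    (interior_subset hτ : _ ∈ hexRegion ε S)
  rw [hexInterp_lineMap_latticePt hε S hbx h0.le h1, indicator_of_notMem hb, ← heq] at this
  linarith

theorem closure_interior_hexRegion {ε : ℝ} (hε : 0 < ε) (S : Set (ℤ × ℤ)) :
    closure (interior (hexRegion ε S)) = hexRegion ε S := by
  refine Subset.antisymm ((isClosed_hexRegion ε S).closure_interior_subset) fun x hx => ?_
  rw [interior_hexRegion hε, mem_closure_iff]
  intro U hU hxU
  have hx' : 1 / 2 ≤ hexInterp ε S x := hx
  obtain ⟨b, hb, hbx⟩ := exists_hat_pos_of_hexInterp_pos (show 0 < hexInterp ε S x by linarith)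
  obtain ⟨τ, h0, h1, hτ⟩ := exists_lineMap_mem hU hxU (latticePt ε b)
  refine ⟨_, hτ, ?_⟩
  rw [mem_ofPred_eq, hexInterp_lineMap_latticePt hε S hbx h0.le h1, indicator_of_mem hb,
    Pi.one_apply]
  nlinarith

theorem frontier_hexRegion {ε : ℝ} (hε : 0 < ε) (S : Set (ℤ × ℤ)) :
    frontier (hexRegion ε S) = {x | hexInterp ε S x = 1 / 2} := by
  rw [frontier, (isClosed_hexRegion ε S).closure_eq, interior_hexRegion hε]
  ext x
  simp only [hexRegion, mem_sdiff, mem_ofPred_eq, not_lt]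
  exact ⟨fun h => le_antisymm h.2 h.1, fun h => ⟨h.ge, h.le⟩⟩

theorem latticePt_add_hexStep (ε : ℝ) (a : ℤ × ℤ) (d : Fin 6) :
    latticePt ε (a + hexStep d) = triPt ε a d 1 0 := by
  simp [latticePt, triPt]

/-- The interpolation equals `1` on lattice edges within `S`, and every point of the open region
sees a lattice point of `S` along a segment with values above `1 / 2`. -/
theorem isConnected_interior_hexRegion {ε : ℝ} (hε : 0 < ε) {S : Set (ℤ × ℤ)}
    (hS : IsHexConnected S) (hne : S.Nonempty) : IsConnected (interior (hexRegion ε S)) := by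
  rw [interior_hexRegion hε]
  obtain ⟨a₀, ha₀⟩ := hne
  set G := {x | 1 / 2 < hexInterp ε S x} with hG
  have hmem : ∀ a ∈ S, latticePt ε a ∈ G := by
    intro a ha
    rw [hG, mem_ofPred_eq, hexInterp_latticePt hε, indicator_of_mem ha, Pi.one_apply]
    norm_num
  have hsub : S ⊆ {a | JoinedIn G (latticePt ε a₀) (latticePt ε a)} := by
    refine hS _ ⟨a₀, ha₀, JoinedIn.refl (hmem a₀ ha₀)⟩ ?_
    rintro a ⟨ha, haJ⟩ d hd
    refine JoinedIn.trans haJ (JoinedIn.of_segment_subset ?_)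
    rw [segment_eq_image_lineMap]
    rintro _ ⟨τ, ⟨h0, h1⟩, rfl⟩
    rw [hG, mem_ofPred_eq, latticePt_add_hexStep, ← triPt_zero_zero ε a d, lineMap_triPt,
      hexInterp_triPt hε S a d (by linarith) (by linarith) (by linarith), if_pos ha, if_pos hd]
    simp
    norm_num
  refine IsPathConnected.isConnected ⟨latticePt ε a₀, hmem a₀ ha₀, fun {x} hx => ?_⟩
  have hx' : 1 / 2 < hexInterp ε S x := hx
  obtain ⟨b, hb, hbx⟩ := exists_hat_pos_of_hexInterp_pos (show 0 < hexInterp ε S x by linarith)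
  refine JoinedIn.trans (hsub hb) (JoinedIn.symm (JoinedIn.of_segment_subset ?_))
  rw [segment_eq_image_lineMap]
  rintro _ ⟨τ, ⟨h0, h1⟩, rfl⟩
  rw [hG, mem_ofPred_eq, hexInterp_lineMap_latticePt hε S hbx h0 h1, indicator_of_mem hb,
    Pi.one_apply]
  rcases h0.eq_or_lt with rfl | h0
  · simpa using hx'
  · nlinarith [mul_nonneg (sub_nonneg.2 h1) (sub_nonneg.2 hx'.le)]

/-! ### The boundary polygon -/

/-- The midpoint of a lattice edge. -/
noncomputable def dartMid (ε : ℝ) (p : (ℤ × ℤ) × Fin 6) : Plane := triPt ε p.1 p.2 (1 / 2) 0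

theorem dartMid_eq_of_add_one (ε : ℝ) (a : ℤ × ℤ) (d : Fin 6) :
    dartMid ε (a, d + 1) = triPt ε a d 0 (1 / 2) := by
  simp [dartMid, triPt]

theorem dartMid_eq_of_sub_one (ε : ℝ) (a : ℤ × ℤ) (d : Fin 6) :
    dartMid ε (a + hexStep (d + 1), d - 1) = triPt ε a d (1 / 2) (1 / 2) := by
  have h : hexStep (d - 1) = hexStep d - hexStep (d + 1) := by revert d; decide
  unfold dartMid triPt
  simp only [h]
  congr 2
  · push_cast [Prod.fst_add, Prod.fst_sub]; ring
  · congr 1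
    push_cast [Prod.snd_add, Prod.snd_sub]; ring

theorem lineMap_dartMid_of_mem {ε : ℝ} {S : Set (ℤ × ℤ)} {a : ℤ × ℤ} {d : Fin 6}
    (h : a + hexStep (d + 1) ∈ S) (τ : ℝ) :
    AffineMap.lineMap (dartMid ε (a, d)) (dartMid ε (nextDart S (a, d))) τ =
      triPt ε a d (1 / 2) (τ / 2) := by
  rw [nextDart, if_pos h, dartMid_eq_of_sub_one, dartMid, lineMap_triPt]
  congr 1 <;> ring

theorem lineMap_dartMid_of_notMem {ε : ℝ} {S : Set (ℤ × ℤ)} {a : ℤ × ℤ} {d : Fin 6}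
    (h : a + hexStep (d + 1) ∉ S) (τ : ℝ) :
    AffineMap.lineMap (dartMid ε (a, d)) (dartMid ε (nextDart S (a, d))) τ =
      triPt ε a d ((1 - τ) / 2) (τ / 2) := by
  rw [nextDart, if_neg h, dartMid_eq_of_add_one, dartMid, lineMap_triPt]
  congr 1 <;> ring

/-- The hat functions on a half-open boundary edge. -/
theorem hat_lineMap_dartMid {ε : ℝ} (hε : 0 < ε) (S : Set (ℤ × ℤ)) (a : ℤ × ℤ) (d : Fin 6) {τ : ℝ}
    (h0 : 0 ≤ τ) (h1 : τ < 1) {x : Plane}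
    (hx : x = AffineMap.lineMap (dartMid ε (a, d)) (dartMid ε (nextDart S (a, d))) τ) :
    0 < hat ε a x ∧ 0 < hat ε (a + hexStep d) x ∧ hat ε (a + hexStep (d + 1)) x = τ / 2 ∧
      ∀ b, 0 < hat ε b x → b = a ∨ b = a + hexStep d ∨ b = a + hexStep (d + 1) := by
  have n1 := hexStep_ne_zero d
  have n2 := hexStep_ne_zero (d + 1)
  have n3 := hexStep_add_one_ne d
  have main : ∀ s, 0 < s → s + τ / 2 < 1 → x = triPt ε a d s (τ / 2) →
      0 < hat ε a x ∧ 0 < hat ε (a + hexStep d) x ∧ hat ε (a + hexStep (d + 1)) x = τ / 2 ∧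
      ∀ b, 0 < hat ε b x → b = a ∨ b = a + hexStep d ∨ b = a + hexStep (d + 1) := by
    rintro s hs hst rfl
    have hh := hat_triPt hε a d hs.le (by linarith : 0 ≤ τ / 2) hst.le
    refine ⟨?_, ?_, ?_, fun b hb => ?_⟩
    · rw [hh, if_pos rfl]; linarith
    · rw [hh]; simp [n1, hs]
    · rw [hh]; simp [n2, n3]
    · rw [hh] at hb
      by_contra! hcon
      rw [if_neg hcon.1, if_neg hcon.2.1, if_neg hcon.2.2] at hb
      exact lt_irrefl _ hb
  by_cases hc : a + hexStep (d + 1) ∈ S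
  · rw [lineMap_dartMid_of_mem hc] at hx
    exact main _ (by norm_num) (by linarith) hx
  · rw [lineMap_dartMid_of_notMem hc] at hx
    exact main _ (by linarith) (by linarith) hx

/-- The half-open boundary edges are pairwise disjoint and not self-intersecting. -/
theorem lineMap_dartMid_inj {ε : ℝ} (hε : 0 < ε) {S : Set (ℤ × ℤ)} {p q : (ℤ × ℤ) × Fin 6}
    (hp : p ∈ boundaryDarts S) (hq : q ∈ boundaryDarts S) {τ σ : ℝ} (hτ : τ ∈ Ico 0 1)
    (hσ : σ ∈ Ico 0 1)
    (h : (AffineMap.lineMap (dartMid ε p) (dartMid ε (nextDart S p)) τ : Plane) =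
      AffineMap.lineMap (dartMid ε q) (dartMid ε (nextDart S q)) σ) : p = q ∧ τ = σ := by
  obtain ⟨a, d⟩ := p
  obtain ⟨a', d'⟩ := q
  obtain ⟨ha, hb⟩ := hp
  obtain ⟨ha', hb'⟩ := hq
  simp only at ha hb ha' hb'
  obtain ⟨p1, p2, p3, p4⟩ := hat_lineMap_dartMid hε S a d hτ.1 hτ.2 rfl
  obtain ⟨q1, q2, q3, q4⟩ := hat_lineMap_dartMid hε S a' d' hσ.1 hσ.2 h
  have hab : a' ≠ a + hexStep d := fun h => hb (h ▸ ha')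
  have hba : a' + hexStep d' ≠ a := fun h => hb' (h ▸ ha)
  -- The hats positive at the common point confine the vertices of each dart to the triangle of the
  -- other. Membership in `S` and the cyclic order exclude all cases but equality, and then the
  -- third hat recovers the parameter.
  rcases p4 _ q1 with e1 | e1 | e1
  · subst e1
    rcases p4 _ q2 with e2 | e2 | e2
    · exact absurd e2 hba
    · obtain rfl := hexStep_injective (add_left_cancel e2)
      exact ⟨rfl, by linarith⟩
    · obtain rfl := hexStep_injective (add_left_cancel e2)
      exfalso
      rcases q4 _ p2 with e3 | e3 | e3
      · exact hexStep_ne_zero d (by simpa using e3)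
      · exact hexStep_add_one_ne d (add_left_cancel e3).symm
      · have := hexStep_injective (add_left_cancel e3)
        omega
  · exact absurd e1 hab
  · exfalso
    subst e1
    rcases p4 _ q2 with e2 | e2 | e2
    · exact hba e2
    · have hd' : d' = d - 1 := by
        apply hexStep_injective
        rw [← hexStep_add_one_add_sub_one a d] at e2
        exact add_left_cancel e2
      subst hd'
      rcases q4 _ p1 with e3 | e3 | e3
      · exact hexStep_ne_zero (d + 1) (by simpa using e3)
      · exact hba e3.symm
      · rw [sub_add_cancel, add_assoc] at e3
        have h0 : hexStep (d + 1) + hexStep d = 0 := by simpa using e3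
        clear * - h0
        revert d
        decide
    · exact hexStep_ne_zero d' (by simpa using e2)

/-- In each mixed triangle the level set is the segment joining the midpoints of the two mixed
sides, the midpoints of a dart and its successor. -/
theorem hexInterp_eq_half_iff {ε : ℝ} (hε : 0 < ε) (S : Set (ℤ × ℤ)) :
    {x | hexInterp ε S x = 1 / 2} =
      ⋃ p ∈ boundaryDarts S, segment ℝ (dartMid ε p) (dartMid ε (nextDart S p)) := by
  classical
  ext x
  simp only [mem_ofPred_eq, mem_iUnion, segment_eq_image_lineMap]
  constructor
  · intro hx
    -- The base vertex is rotated, if necessary, so that it lies in `S` and the next vertex does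
    -- not.
    have key : ∃ a d s t, 0 ≤ s ∧ 0 ≤ t ∧ s + t ≤ 1 ∧ x = triPt ε a d s t ∧ a ∈ S ∧
        a + hexStep d ∉ S := by
      obtain ⟨a, ha, hax⟩ := exists_hat_pos_of_hexInterp_pos
        (show 0 < hexInterp ε S x by rw [hx]; norm_num)
      obtain ⟨d, s, t, hs, ht, hst, rfl⟩ := exists_eq_triPt_of_hat_pos hε hax
      by_cases hb : a + hexStep d ∈ S
      · by_cases hc : a + hexStep (d + 1) ∈ S
        · rw [hexInterp_triPt hε S a d hs ht hst, if_pos ha, if_pos hb, if_pos hc] at hx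
          linarith
        · exact ⟨_, _, t, 1 - s - t, ht, by linarith, by linarith, (triPt_rotate ..).symm, hb,
            by rwa [add_assoc, hexStep_add_two]⟩
      · exact ⟨a, d, s, t, hs, ht, hst, rfl, ha, hb⟩
    obtain ⟨a, d, s, t, hs, ht, hst, rfl, ha, hb⟩ := key
    rw [hexInterp_triPt hε S a d hs ht hst, if_pos ha, if_neg hb] at hx
    refine ⟨(a, d), ⟨ha, hb⟩, 2 * t, ?_, ?_⟩
    · split_ifs at hx <;> constructor <;> linarith
    · by_cases hc : a + hexStep (d + 1) ∈ S
      · rw [lineMap_dartMid_of_mem hc]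
        rw [if_pos hc] at hx
        congr 1 <;> linarith
      · rw [lineMap_dartMid_of_notMem hc]
        rw [if_neg hc] at hx
        congr 1 <;> linarith
  · rintro ⟨⟨a, d⟩, ⟨ha, hb⟩, τ, ⟨h0, h1⟩, rfl⟩
    simp only at ha hb
    by_cases hc : a + hexStep (d + 1) ∈ S
    · rw [lineMap_dartMid_of_mem hc, hexInterp_triPt hε S a d (by linarith) (by linarith)
        (by linarith), if_pos ha, if_neg hb, if_pos hc]
      ring
    · rw [lineMap_dartMid_of_notMem hc, hexInterp_triPt hε S a d (by linarith) (by linarith)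
        (by linarith), if_pos ha, if_neg hb, if_neg hc]
      ring

/-- A cyclic sequence of points whose half-open edges are disjoint spans a simple closed polygon. -/
theorem exists_isSimplePolygon {w : ℕ → Plane} {m : ℕ} (hm : 0 < m) (hw : w m = w 0)
    (hinj : ∀ i < m, ∀ j < m, ∀ τ ∈ Ico (0 : ℝ) 1, ∀ σ ∈ Ico (0 : ℝ) 1,
      (AffineMap.lineMap (w i) (w (i + 1)) τ : Plane) = AffineMap.lineMap (w j) (w (j + 1)) σ →
      i = j ∧ τ = σ) :
    ∃ u : C(Circle, Plane), IsSimplePolygon u ∧ range u = ⋃ i < m, segment ℝ (w i) (w (i + 1)) := by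
  -- Each clamped summand adds one edge during its unit of time, so `g` runs along the `i`-th edge
  -- on `[i, i + 1]`.
  set g : ℝ → Plane := fun t =>
    w 0 + ∑ i ∈ Finset.range m, max 0 (min 1 (t - i)) • (w (i + 1) - w i) with hg
  have hgc : Continuous g := by fun_prop
  have hgi : ∀ i < m, ∀ τ ∈ Icc (0 : ℝ) 1, g (i + τ) = AffineMap.lineMap (w i) (w (i + 1)) τ := by
    rintro i hi τ ⟨h0, h1⟩
    have e1 : ∑ j ∈ Finset.range m, max 0 (min 1 ((i + τ : ℝ) - j)) • (w (j + 1) - w j) =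
        ∑ j ∈ Finset.range (i + 1), max 0 (min 1 ((i + τ : ℝ) - j)) • (w (j + 1) - w j) := by
      symm
      apply Finset.sum_subset (Finset.range_mono hi)
      intro j _ hj
      rw [Finset.mem_range, not_lt] at hj
      have : ((i + 1 : ℕ) : ℝ) ≤ j := by exact_mod_cast hj
      push_cast at this
      rw [max_eq_left ((min_le_right _ _).trans (by linarith)), zero_smul]
    have e2 : ∑ j ∈ Finset.range i, max 0 (min 1 ((i + τ : ℝ) - j)) • (w (j + 1) - w j) =
        ∑ j ∈ Finset.range i, (w (j + 1) - w j) := by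
      apply Finset.sum_congr rfl
      intro j hj
      rw [Finset.mem_range] at hj
      have : ((j + 1 : ℕ) : ℝ) ≤ i := by exact_mod_cast hj
      push_cast at this
      rw [min_eq_left (by linarith), max_eq_right zero_le_one, one_smul]
    simp only [hg]
    rw [e1, Finset.sum_range_succ, e2, Finset.sum_range_sub, add_sub_cancel_left, min_eq_right h1,
      max_eq_right h0, AffineMap.lineMap_apply_module']
    abel
  have hgt : ∀ t ∈ Ico (0 : ℝ) m, ∃ i < m, ∃ τ ∈ Ico (0 : ℝ) 1, t = i + τ := by
    rintro t ⟨h0, h1⟩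
    refine ⟨⌊t⌋₊, (Nat.floor_lt h0).2 h1, t - ⌊t⌋₊, ⟨?_, ?_⟩, by ring⟩
    · linarith [Nat.floor_le h0]
    · linarith [Nat.lt_floor_add_one t]
  have hm0 : (0 : ℝ) < m := by exact_mod_cast hm
  have hg0 : g 0 = w 0 := by
    have := hgi 0 hm 0 ⟨le_rfl, zero_le_one⟩
    simpa using this
  have hgm : g m = w 0 := by
    have := hgi (m - 1) (by omega) 1 ⟨zero_le_one, le_rfl⟩
    rw [Nat.cast_sub hm, Nat.cast_one, sub_add_cancel, AffineMap.lineMap_apply_one,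
      Nat.sub_add_cancel hm, hw] at this
    exact this
  have : Fact ((0 : ℝ) < m) := ⟨hm0⟩
  have hlc : Continuous (AddCircle.liftIco (m : ℝ) 0 g) :=
    AddCircle.liftIco_zero_continuous (by rw [hg0, hgm]) hgc.continuousOn
  set Φ := AddCircle.homeomorphCircle (T := (m : ℝ)) hm0.ne' with hΦ
  have hrep : ∀ z : Circle, ∃ t ∈ Ico (0 : ℝ) m, Φ (t : AddCircle (m : ℝ)) = z ∧
      AddCircle.liftIco (m : ℝ) 0 g (Φ.symm z) = g t := by
    intro z
    obtain ⟨t, ht, htz⟩ : Φ.symm z ∈ (fun t : ℝ => (t : AddCircle (m : ℝ))) '' Ico 0 (0 + m) := by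
      rw [AddCircle.coe_image_Ico_eq]; exact mem_univ _
    rw [zero_add] at ht
    refine ⟨t, ht, by simp only at htz; rw [htz, Φ.apply_symm_apply], ?_⟩
    simp only at htz
    rw [← htz, AddCircle.liftIco_zero_coe_apply ht]
  set u : C(Circle, Plane) := ⟨fun z => AddCircle.liftIco (m : ℝ) 0 g (Φ.symm z),
    hlc.comp Φ.symm.continuous⟩ with hu
  have huinj : Function.Injective u := by
    intro y z hyz
    obtain ⟨t, ht, hty, hgt1⟩ := hrep y
    obtain ⟨s, hs, hsz, hgs⟩ := hrep z
    have e : g t = g s := by rw [← hgt1, ← hgs]; exact hyz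
    obtain ⟨i, hi, τ, hτ, rfl⟩ := hgt t ht
    obtain ⟨j, hj, σ, hσ, rfl⟩ := hgt s hs
    rw [hgi i hi τ ⟨hτ.1, hτ.2.le⟩, hgi j hj σ ⟨hσ.1, hσ.2.le⟩] at e
    obtain ⟨rfl, rfl⟩ := hinj i hi j hj τ hτ σ hσ e
    rw [← hty, ← hsz]
  have hrange : range u = ⋃ i < m, segment ℝ (w i) (w (i + 1)) := by
    ext x
    simp only [mem_iUnion, segment_eq_image_lineMap]
    constructor
    · rintro ⟨z, rfl⟩
      obtain ⟨t, ht, -, hgt1⟩ := hrep z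
      obtain ⟨i, hi, τ, hτ, rfl⟩ := hgt t ht
      refine ⟨i, hi, τ, ⟨hτ.1, hτ.2.le⟩, ?_⟩
      rw [← hgi i hi τ ⟨hτ.1, hτ.2.le⟩, ← hgt1]
      rfl
    · rintro ⟨i, hi, τ, hτ, rfl⟩
      have hval : ∀ t ∈ Ico (0 : ℝ) m, g t ∈ range u := by
        intro t ht
        refine ⟨Φ (t : AddCircle (m : ℝ)), ?_⟩
        change AddCircle.liftIco (m : ℝ) 0 g (Φ.symm (Φ t)) = g t
        rw [Φ.symm_apply_apply, AddCircle.liftIco_zero_coe_apply ht]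
      rw [← hgi i hi τ hτ]
      have hi' : ((i + 1 : ℕ) : ℝ) ≤ m := by exact_mod_cast hi
      push_cast at hi'
      rcases lt_or_eq_of_le (show (i : ℝ) + τ ≤ m by linarith [hτ.2]) with h | h
      · exact hval _ ⟨by linarith [hτ.1, Nat.cast_nonneg (α := ℝ) i], h⟩
      · rw [h, hgm, ← hg0]
        exact hval 0 ⟨le_rfl, hm0⟩
  -- A single edge would be constant, and two edges would retrace each other and share their
  -- midpoint.
  have hm3 : 3 ≤ m := by
    by_contra! hlt
    obtain rfl | rfl : m = 1 ∨ m = 2 := by omega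
    · have := (hinj 0 hm 0 hm 0 (by norm_num) (1 / 2) (by norm_num) (by simp [hw])).2
      norm_num at this
    · have := (hinj 0 hm 1 (by norm_num) (1 / 2) (by norm_num) (1 / 2) (by norm_num) (by
        rw [zero_add, show (1 + 1 : ℕ) = 2 from rfl, hw, AffineMap.lineMap_apply_module,
          AffineMap.lineMap_apply_module, add_comm]
        norm_num)).1
      norm_num at this
  obtain ⟨k, rfl⟩ : ∃ k, m = k + 3 := ⟨m - 3, by omega⟩
  refine ⟨u, ⟨huinj, k, fun i => w i, ?_⟩, hrange⟩
  rw [hrange]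
  ext x
  simp only [mem_iUnion]
  have hnext : ∀ i : Fin (k + 3), w ((i + 1 : Fin (k + 3)) : ℕ) = w (i + 1) := by
    intro i
    rw [Fin.val_add_one]
    split_ifs with h
    · rw [h, Fin.val_last, ← hw]
    · rfl
  constructor
  · rintro ⟨i, hi, hx⟩
    exact ⟨⟨i, hi⟩, by rw [hnext]; exact hx⟩
  · rintro ⟨i, hx⟩
    exact ⟨i, i.2, by rw [hnext] at hx; exact hx⟩

/-- If a set of lattice points and its complement are connected and nonempty, and only finitely
many edges leave it, then it cuts out a polygonal region. -/
theorem exists_isPolygonalRegion_hexRegion {ε : ℝ} (hε : 0 < ε) {S : Set (ℤ × ℤ)}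
    (hS : IsHexConnected S) (hSc : IsHexConnected Sᶜ) (hne : S.Nonempty)
    (hfin : (boundaryDarts S).Finite) (hB : (boundaryDarts S).Nonempty) :
    ∃ u : C(Circle, Plane), IsPolygonalRegion (hexRegion ε S) u := by
  obtain ⟨p₀, hp₀⟩ := hB
  have : Finite (boundaryDarts S) := hfin
  have hmaps : MapsTo (nextDart S) (boundaryDarts S) (boundaryDarts S) := fun p hp => nextDart_mem hp
  set F : boundaryDarts S → boundaryDarts S := hmaps.restrict with hF
  have hFinj : Function.Injective F := hmaps.restrict_inj.2 (nextDart_injOn S)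
  set P : boundaryDarts S := ⟨p₀, hp₀⟩
  have hper := hFinj.mem_periodicPts P
  have hm : 0 < Function.minimalPeriod F P := Function.minimalPeriod_pos_of_mem_periodicPts hper
  set m := Function.minimalPeriod F P with hmdef
  have hFm : F^[m] P = P := Function.iterate_minimalPeriod
  have hsucc : ∀ i, ((F^[i + 1] P : boundaryDarts S) : (ℤ × ℤ) × Fin 6) = nextDart S (F^[i] P) := by
    intro i
    rw [Function.iterate_succ_apply']
    rfl
  obtain ⟨u, hu, hur⟩ := exists_isSimplePolygon (w := fun i => dartMid ε (F^[i] P)) (m := m) hm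
    (by simp only [hFm]; rfl) (by
      intro i hi j hj τ hτ σ hσ h
      simp only [hsucc] at h
      obtain ⟨h1, h2⟩ := lineMap_dartMid_inj hε (F^[i] P).2 (F^[j] P).2 hτ hσ h
      exact ⟨Function.iterate_injOn_Iio_minimalPeriod hi hj (Subtype.ext h1), h2⟩)
  -- One orbit of the walk is the whole boundary, so the polygon traced over a minimal period is the
  -- full level set and not just one of several boundary curves.
  have hall : ∀ p ∈ boundaryDarts S, ∃ i, ((F^[i] P : boundaryDarts S) : (ℤ × ℤ) × Fin 6) = p := by
    refine boundaryDarts_subset_of_nextDart hS hSc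
      (O := {p | ∃ i, ((F^[i] P : boundaryDarts S) : (ℤ × ℤ) × Fin 6) = p}) ?_ ⟨p₀, 0, rfl⟩ ?_
    · rintro _ ⟨i, rfl⟩
      exact (F^[i] P).2
    · intro p hp
      constructor
      · rintro ⟨i, hi⟩
        -- Going on `m - 1` steps in a cycle of length `m` amounts to one step back.
        refine ⟨i + (m - 1), ?_⟩
        have e : F^[i + (m - 1) + 1] P = F ⟨p, hp⟩ := by
          rw [add_assoc, Nat.sub_add_cancel hm, Function.iterate_add_apply, hFm]
          exact Subtype.ext hi
        rw [Function.iterate_succ_apply'] at e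
        rw [hFinj e]
      · rintro ⟨i, rfl⟩
        exact ⟨i + 1, hsucc i⟩
  refine ⟨u, closure_interior_hexRegion hε S, isConnected_interior_hexRegion hε hS hne, hu, ?_⟩
  rw [frontier_hexRegion hε, hexInterp_eq_half_iff hε, hur]
  ext x
  simp only [mem_iUnion, hsucc]
  constructor
  · rintro ⟨p, hp, hx⟩
    obtain ⟨i, rfl⟩ := hall p hp
    refine ⟨i % m, Nat.mod_lt _ hm, ?_⟩
    rwa [hmdef, Function.iterate_mod_minimalPeriod_eq]
  · rintro ⟨i, -, hx⟩
    exact ⟨_, (F^[i] P).2, hx⟩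

/-! ### Regions in the complement of `K` at a given scale -/

/-- The lattice points whose open stars meet `A`. -/
def starPts (ε : ℝ) (A : Set Plane) : Set (ℤ × ℤ) := {b | ∃ x ∈ A, 0 < hat ε b x}

/-- The open stars over `T` and over its complement cover `A`. As `A` is connected, two of them meet
in `A`, and overlapping stars have adjacent centres. -/
theorem isHexConnected_starPts {ε : ℝ} (hε : 0 < ε) {A : Set Plane} (hA : IsPreconnected A) :
    IsHexConnected (starPts ε A) := by
  intro T hT hTstep b hb
  by_contra hbT
  have hopen : ∀ B : Set (ℤ × ℤ), IsOpen (⋃ b ∈ B, {x | 0 < hat ε b x}) := fun B =>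
    isOpen_biUnion fun b _ => isOpen_lt continuous_const (continuous_hat ε b)
  obtain ⟨c, ⟨y, hyA, hcy⟩, hcT⟩ := hT
  obtain ⟨z, hzA, hbz⟩ := hb
  obtain ⟨x, hxA, hxU, hxV⟩ := hA _ _ (hopen T) (hopen Tᶜ)
    (fun x hx => by
      obtain ⟨a, ha⟩ := exists_hat_pos hε x
      by_cases haT : a ∈ T
      · exact Or.inl (mem_biUnion haT ha)
      · exact Or.inr (mem_biUnion haT ha))
    ⟨y, hyA, mem_biUnion hcT hcy⟩ ⟨z, hzA, mem_biUnion hbT hbz⟩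
  simp only [mem_iUnion, mem_ofPred_eq] at hxU hxV
  obtain ⟨a, haT, hax⟩ := hxU
  obtain ⟨a', haT', hax'⟩ := hxV
  obtain ⟨d, rfl⟩ := exists_hexStep_of_hat_pos hε hax hax' (fun h => haT' (h ▸ haT))
  exact haT' (hTstep a ⟨⟨x, hxA, hax⟩, haT⟩ d ⟨x, hxA, hax'⟩)

theorem finite_starPts {ε : ℝ} {A : Set Plane} (hA : Bornology.IsBounded A) :
    (starPts ε A).Finite := by
  obtain ⟨R, hR⟩ := hA.exists_norm_le
  set N : ℤ := ⌈R / |ε|⌉ + 1 with hN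
  refine ((finite_Icc (-N) N).prod (finite_Icc (-N) N)).subset ?_
  rintro ⟨m, n⟩ ⟨x, hx, hpos⟩
  obtain ⟨h0, h1, -⟩ := hat_pos_iff.1 hpos
  have key : ∀ i : Fin 2, ∀ k : ℤ, |x i / ε - k| < 1 → k ∈ Icc (-N) N := by
    intro i k hk
    have h2 : |x i / ε| ≤ R / |ε| := by
      rw [abs_div]
      gcongr
      exact (PiLp.norm_apply_le x i).trans (hR x hx)
    have h3 : |(k : ℝ)| < N := by
      have h4 := abs_sub_abs_le_abs_sub (k : ℝ) (x i / ε)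
      rw [abs_sub_comm] at h4
      have h5 := Int.le_ceil (R / |ε|)
      rw [hN]
      push_cast
      linarith
    have h6 : |k| < N := by exact_mod_cast h3
    exact abs_le.1 h6.le
  exact ⟨key 0 m h0, key 1 n h1⟩

theorem boundaryDarts_nonempty {S : Set (ℤ × ℤ)} (hne : S.Nonempty) (hne' : Sᶜ.Nonempty) :
    (boundaryDarts S).Nonempty := by
  by_contra hcon
  rw [not_nonempty_iff_eq_empty, eq_empty_iff_forall_notMem] at hcon
  obtain ⟨a, ha⟩ := hne
  obtain ⟨b, hb⟩ := hne'
  refine hb (isHexConnected_univ S ⟨a, mem_univ a, ha⟩ ?_ (mem_univ b))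
  rintro x ⟨-, hx⟩ d -
  by_contra h
  exact hcon (x, d) ⟨hx, h⟩

/-- Leaving a component of the complement of `E` means entering `E`. -/
theorem mem_of_mem_boundaryDarts_hexComponent {E : Set (ℤ × ℤ)} {g : ℤ × ℤ}
    {p : (ℤ × ℤ) × Fin 6} (hp : p ∈ boundaryDarts (hexComponent Eᶜ g)) :
    p.1 + hexStep p.2 ∈ E := by
  by_contra h
  exact hp.2 (add_mem_hexComponent hp.1 h)

/-- This finiteness bounds both the boundary edges of one region and the number of regions at one
scale. -/
theorem finite_darts_into {E : Set (ℤ × ℤ)} (hE : E.Finite) :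
    {p : (ℤ × ℤ) × Fin 6 | p.1 + hexStep p.2 ∈ E}.Finite := by
  refine ((hE.prod (finite_univ (α := Fin 6))).image fun q => (q.1 - hexStep q.2, q.2)).subset ?_
  rintro ⟨a, d⟩ h
  exact ⟨(a + hexStep d, d), ⟨h, mem_univ _⟩, by simp⟩

/-- Every boundary point of a complementary region of `K` on the lattice of mesh `ε` is joined to
`K` by a short path outside this region. -/
theorem exists_joinedIn_of_mem_frontier_hexRegion {ε : ℝ} (hε : 0 < ε) {K : Set Plane}
    {g : ℤ × ℤ} (hg : g ∉ starPts ε K) {p : Plane}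
    (hp : p ∈ frontier (hexRegion ε (hexComponent (starPts ε K)ᶜ g))) :
    ∃ k ∈ K, JoinedIn (insert p ((hexRegion ε (hexComponent (starPts ε K)ᶜ g))ᶜ ∩
      Metric.closedBall p (4 * ε))) p k := by
  set S := hexComponent (starPts ε K)ᶜ g with hS
  have hSE : S ⊆ (starPts ε K)ᶜ := hexComponent_subset hg
  have hp : hexInterp ε S p = 1 / 2 := by rwa [frontier_hexRegion hε] at hp
  obtain ⟨a, ha, hap⟩ := exists_hat_pos_of_hexInterp_pos (show 0 < hexInterp ε S p by
    rw [hp]; norm_num)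
  obtain ⟨b, hb, hbp⟩ := exists_hat_pos_of_hexInterp_lt_one hε (show hexInterp ε S p < 1 by
    rw [hp]; norm_num)
  have hbE : b ∈ starPts ε K := by
    obtain ⟨d, rfl⟩ := exists_hexStep_of_hat_pos hε hap hbp (fun h => hb (h ▸ ha))
    by_contra h
    exact hb (add_mem_hexComponent ha h)
  obtain ⟨k, hk, hbk⟩ := hbE
  have hk0 : hexInterp ε S k = 0 := hexInterp_eq_zero fun c hc hcS => hSE hcS ⟨k, hk, hc⟩
  have d1 := dist_latticePt_le hε hbp
  have d2 := dist_latticePt_le hε hbk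
  -- The path goes through a lattice point `b` of `E` within `2 * ε` of both `p` and `k`. From `p`
  -- the value drops below `1 / 2` at once, and between `b` and `k` it is `0`.
  refine ⟨k, hk, JoinedIn.trans (y := latticePt ε b) (JoinedIn.of_segment_subset ?_)
    (JoinedIn.symm (JoinedIn.of_segment_subset ?_))⟩
  · intro y hy
    have hyb := (convex_closedBall p (2 * ε)).segment_subset (Metric.mem_closedBall_self (by linarith))
      (Metric.mem_closedBall'.2 d1) hy
    rw [segment_eq_image_lineMap] at hy
    obtain ⟨τ, ⟨h0, h1⟩, rfl⟩ := hy
    rcases h0.eq_or_lt with rfl | h0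
    · left; simp
    · refine Or.inr ⟨fun h => ?_, Metric.closedBall_subset_closedBall (by linarith) hyb⟩
      have h : 1 / 2 ≤ hexInterp ε S _ := h
      rw [hexInterp_lineMap_latticePt hε S hbp h0.le h1, indicator_of_notMem hb, hp] at h
      linarith
  · intro y hy
    have hyb := (convex_closedBall (latticePt ε b) (2 * ε)).segment_subset
      (Metric.mem_closedBall.2 d2) (Metric.mem_closedBall_self (by linarith)) hy
    rw [segment_eq_image_lineMap] at hy
    obtain ⟨τ, ⟨h0, h1⟩, rfl⟩ := hy
    refine Or.inr ⟨fun h => ?_, ?_⟩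
    · have h : 1 / 2 ≤ hexInterp ε S _ := h
      rw [hexInterp_lineMap_latticePt hε S hbk h0 h1, indicator_of_notMem hb, hk0] at h
      linarith
    · rw [Metric.mem_closedBall] at hyb ⊢
      have := dist_triangle_right (AffineMap.lineMap k (latticePt ε b) τ : Plane) p (latticePt ε b)
      linarith

/-- On each scale `ε` there are finitely many polygonal regions in the complement of `K`, with
boundary at distance at most `4 * ε` from `K`, such that every connected set at a larger distance
from `K` is contained in one of them. -/
theorem exists_finite_polygonalRegions {K : Set Plane} (hconn : IsConnected K)
    (hcomp : IsCompact K) {ε : ℝ} (hε : 0 < ε) :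
    ∃ 𝓕 : Set (Set Plane × C(Circle, Plane)), 𝓕.Finite ∧
      (∀ q ∈ 𝓕, IsPolygonalRegion q.1 q.2 ∧ Disjoint K q.1 ∧ ∀ p ∈ range q.2, ∃ k ∈ K,
        JoinedIn (insert p (q.1ᶜ ∩ Metric.closedBall p (4 * ε))) p k) ∧
      ∀ Q : Set Plane, IsPreconnected Q → Q.Nonempty →
        (∀ x ∈ Q, ∀ k ∈ K, 4 * ε < dist x k) → ∃ q ∈ 𝓕, Q ⊆ q.1 := by
  set E := starPts ε K with hE
  have hEconn : IsHexConnected E := isHexConnected_starPts hε hconn.isPreconnected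
  have hEne : E.Nonempty := by
    obtain ⟨k, hk⟩ := hconn.nonempty
    obtain ⟨a, ha⟩ := exists_hat_pos hε k
    exact ⟨a, k, hk, ha⟩
  have hEfin : E.Finite := finite_starPts hcomp.isBounded
  have hbd : ∀ g, g ∉ E → (boundaryDarts (hexComponent Eᶜ g)).Nonempty := fun g hg =>
    boundaryDarts_nonempty ⟨g, mem_hexComponent_self _ g⟩
      (hEne.mono fun e he h => hexComponent_subset hg h he)
  have hpoly : ∀ g, g ∉ E → ∃ u : C(Circle, Plane),
      IsPolygonalRegion (hexRegion ε (hexComponent Eᶜ g)) u := fun g hg =>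
    exists_isPolygonalRegion_hexRegion hε (isHexConnected_hexComponent _ g)
      (isHexConnected_compl_hexComponent hEconn hEne hg) ⟨g, mem_hexComponent_self _ g⟩
      ((finite_darts_into hEfin).subset fun p hp => mem_of_mem_boundaryDarts_hexComponent hp)
      (hbd g hg)
  choose! u hu using hpoly
  refine ⟨(fun p : (ℤ × ℤ) × Fin 6 => (hexRegion ε (hexComponent Eᶜ p.1), u p.1)) ''
    {p | p.1 ∉ E ∧ p.1 + hexStep p.2 ∈ E}, ?_, ?_, ?_⟩
  · exact ((finite_darts_into hEfin).subset fun p hp => hp.2).image _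
  · rintro _ ⟨⟨g, d⟩, ⟨hg, -⟩, rfl⟩
    simp only at hg ⊢
    refine ⟨hu g hg, ?_, fun p hp => ?_⟩
    · rw [disjoint_left]
      intro k hk hkD
      have h : 1 / 2 ≤ hexInterp ε (hexComponent Eᶜ g) k := hkD
      have hsub : hexComponent Eᶜ g ⊆ Eᶜ := hexComponent_subset hg
      rw [hexInterp_eq_zero fun c hc hcS => hsub hcS ⟨k, hk, hc⟩] at h
      norm_num at h
    · rw [← (hu g hg).frontier_eq] at hp
      exact exists_joinedIn_of_mem_frontier_hexRegion hε hg hp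
  · intro Q hQ hQne hdist
    -- A star meeting both `Q` and `K` would give points of them at distance at most `2 * ε + 2 *
    -- ε`.
    have hdisj : ∀ b ∈ starPts ε Q, b ∉ E := by
      rintro b ⟨x, hx, hbx⟩ ⟨k, hk, hbk⟩
      have d1 := dist_latticePt_le hε hbx
      have d2 := dist_latticePt_le hε hbk
      have := hdist x hx k hk
      linarith [dist_triangle_right x k (latticePt ε b)]
    obtain ⟨x, hx⟩ := hQne
    obtain ⟨b, hb⟩ := exists_hat_pos hε x
    have hbQ : b ∈ starPts ε Q := ⟨x, hx, hb⟩
    have hsub : starPts ε Q ⊆ hexComponent Eᶜ b :=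
      isHexConnected_starPts hε hQ _ ⟨b, hbQ, mem_hexComponent_self _ b⟩
        fun a ha d hd => add_mem_hexComponent ha.2 (hdisj _ hd)
    obtain ⟨⟨g, d⟩, hgd⟩ := hbd b (hdisj b hbQ)
    have hgE : g ∉ E := hexComponent_subset (hdisj b hbQ) hgd.1
    refine ⟨_, ⟨(g, d), ⟨hgE, mem_of_mem_boundaryDarts_hexComponent hgd⟩, rfl⟩, ?_⟩
    intro y hy
    change 1 / 2 ≤ hexInterp ε (hexComponent Eᶜ g) y
    rw [hexComponent_eq_of_mem (hdisj b hbQ) hgd.1,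
      hexInterp_eq_one hε fun c hc => hsub ⟨y, hy, hc⟩]
    norm_num

/-! ### Exhaustion of a component and conclusion -/

theorem exists_pos_le_dist_of_isClosed {K D : Set Plane} (hK : IsCompact K) (hD : IsClosed D)
    (hdisj : Disjoint K D) : ∃ η > 0, ∀ x ∈ D, ∀ k ∈ K, η ≤ dist x k := by
  obtain ⟨δ, hδ, h⟩ := hdisj.exists_thickenings hK hD
  refine ⟨δ, hδ, fun x hx k hk => ?_⟩
  by_contra! hlt
  exact disjoint_left.1 h (Metric.mem_thickening_iff.2 ⟨k, hk, hlt⟩)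
    (Metric.self_subset_thickening hδ D hx)

/-- A component of the complement of `K` is exhausted by connected sets that contain a given point
and have a positive distance from `K`. -/
theorem IsComponentOf.exists_exhaustion {K Γ : Set Plane} (hK : IsCompact K) (hne : K.Nonempty)
    (hΓ : IsComponentOf Γ Kᶜ) {x : Plane} (hx : x ∈ Γ) :
    ∃ Q : ℕ → Set Plane, (∀ n, IsPreconnected (Q n)) ∧ (∀ n, x ∈ Q n) ∧ (Γ ⊆ ⋃ n, Q n) ∧
      ∀ n, ∃ η > 0, ∀ y ∈ Q n, ∀ k ∈ K, η ≤ dist y k := by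
  have hpos : ∀ y ∈ Γ, 0 < Metric.infDist y K := fun y hy =>
    (hK.isClosed.notMem_iff_infDist_pos hne).1 (hΓ.subset hy)
  set δ := Metric.infDist x K with hδdef
  have hδ : 0 < δ := hpos x hx
  have hxmem : ∀ n : ℕ, x ∈ {y | δ / (n + 1) ≤ Metric.infDist y K} := fun n =>
    div_le_self hδ.le (by linarith [Nat.cast_nonneg (α := ℝ) n])
  refine ⟨fun n => connectedComponentIn {y | δ / (n + 1) ≤ Metric.infDist y K} x,
    fun n => isPreconnected_connectedComponentIn, fun n => mem_connectedComponentIn (hxmem n),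
    fun y hy => ?_, fun n => ⟨δ / (n + 1), by positivity, fun y hy k hk => ?_⟩⟩
  · have hΓo : IsOpen Γ := by
      obtain ⟨z, -, rfl⟩ := hΓ
      exact hK.isClosed.isOpen_compl.connectedComponentIn
    have hΓp : IsPathConnected Γ :=
      hΓo.isConnected_iff_isPathConnected.1 ⟨⟨x, hx⟩, hΓ.isPreconnected⟩
    obtain ⟨γ, hγ⟩ := hΓp.joinedIn x hx y hy
    -- A path in `Γ` from `x` to `y` is compact and keeps a positive distance from `K`, so it lies
    -- in one of the sets.
    obtain ⟨t, -, ht⟩ := (isCompact_univ (X := unitInterval)).exists_isMinOn univ_nonempty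
      ((Metric.continuous_infDist_pt K).comp γ.continuous).continuousOn
    obtain ⟨n, hn⟩ := exists_nat_gt (δ / Metric.infDist (γ t) K)
    refine mem_iUnion.2 ⟨n, ?_⟩
    refine (isPreconnected_range γ.continuous).subset_connectedComponentIn ⟨0, γ.source⟩ ?_
      ⟨1, γ.target⟩
    rintro _ ⟨s, rfl⟩
    have h1 := ht (mem_univ s)
    simp only [mem_ofPred_eq, Function.comp_apply] at h1
    have h2 := hpos _ (hγ t)
    refine le_trans ?_ h1
    rw [div_lt_iff₀ h2] at hn
    rw [div_le_iff₀ (by positivity)]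
    linarith
  · have h := connectedComponentIn_subset _ _ hy
    rw [mem_ofPred_eq] at h
    exact h.trans (Metric.infDist_le_dist_of_mem hk)

/-- On sufficiently fine scales, the multiplicity of curves close to `K` is bounded. -/
theorem exists_rMultiplicity_bound {K : Set Plane} (hlc : LocallyConnectedSpace K)
    (hne : K.Nonempty) (hcomp : IsCompact K) {r : ℝ} (hr : 0 < r) :
    ∃ N : ℕ, ∀ (D : Set Plane) (u : C(Circle, Plane)) (ε : ℝ), IsPolygonalRegion D u →
      Disjoint K D → ε ≤ r / 16 → (∀ p ∈ range u, ∃ k ∈ K,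
        JoinedIn (insert p (Dᶜ ∩ Metric.closedBall p ε)) p k) → rMultiplicity r u ≤ N := by
  have : CompactSpace K := isCompact_iff_compactSpace.1 hcomp
  have : Nonempty K := hne.to_subtype
  obtain ⟨s, W, hWc, hWd, hW⟩ := exists_finite_preconnected_cover (X := K)
    continuous_subtype_val (show 0 < r / 16 by linarith)
  refine ⟨2 * s.card, fun D u ε hD hKD hε hvis => ?_⟩
  have hDc : IsClosed D := hD.closure_interior ▸ isClosed_closure
  refine rMultiplicity_le_of_cover hr hD.polygon.1 hDc hKD
    (hD.frontier_eq ▸ hDc.frontier_subset) (fun p hp => ?_) s (fun x => Subtype.val '' W x)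
    (fun x => ?_) (fun x => (hWc x).image _ continuous_subtype_val.continuousOn) ?_ ?_
  · obtain ⟨k, hk, hj⟩ := hvis p hp
    exact ⟨k, hk, hj.mono (insert_subset_insert
      (inter_subset_inter_right _ (Metric.closedBall_subset_closedBall hε)))⟩
  · rintro _ ⟨k, -, rfl⟩
    exact k.2
  · rintro x _ ⟨a, ha, rfl⟩ _ ⟨b, hb, rfl⟩
    exact hWd x a ha b hb
  · intro k hk
    obtain ⟨x, hxs, hkx⟩ := hW ⟨k, hk⟩
    exact ⟨x, hxs, ⟨k, hk⟩, hkx, rfl⟩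

theorem mainTheorem9 (K : Set Plane) (hlc : LocallyConnectedSpace K) (hconn : IsConnected K)
    (hcomp : IsCompact K) :
    ∃ C : ℝ → ℕ, ∀ Γ : Set Plane, IsComponentOf Γ Kᶜ →
      ∃ (D : ℕ → Set Plane) (u : ℕ → C(Circle, Plane)),
        (∀ n, IsPolygonalRegion (D n) (u n)) ∧
        (∀ n, D n ⊆ D (n + 1)) ∧
        (Γ = ⋃ n, D n) ∧
        ∀ r : ℝ, 0 < r → ∀ n, rMultiplicity r (u n) < (C r : ℕ∞) := by
  have hscale := fun j : ℕ => exists_finite_polygonalRegions hconn hcomp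
    (show (0 : ℝ) < (1 / 2) ^ j by positivity)
  choose 𝓕 hfin hgood hcover using hscale
  have hsmall : ∀ η : ℝ, 0 < η → ∃ m : ℕ, ∀ j ≥ m, 4 * (1 / 2 : ℝ) ^ j < η := by
    intro η hη
    obtain ⟨m, hm⟩ := exists_pow_lt_of_lt_one (show 0 < η / 4 by linarith)
      (show (1 / 2 : ℝ) < 1 by norm_num)
    refine ⟨m, fun j hj => ?_⟩
    have := pow_le_pow_of_le_one (show (0 : ℝ) ≤ 1 / 2 by norm_num) (by norm_num) hj
    linarith
  have hbound : ∀ r : ℝ, 0 < r → ∃ c : ℕ, ∀ j, ∀ q ∈ 𝓕 j, rMultiplicity r q.2 < (c : ℕ∞) := by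
    intro r hr
    obtain ⟨N, hN⟩ := exists_rMultiplicity_bound hlc hconn.nonempty hcomp hr
    obtain ⟨m, hm⟩ := hsmall (r / 16) (by linarith)
    have hcoarse : (⋃ j ∈ Iio m, 𝓕 j).Finite := (finite_Iio m).biUnion fun j _ => hfin j
    obtain ⟨M, hM⟩ := (hcoarse.image fun q => (rMultiplicity r q.2).toNat).bddAbove
    refine ⟨max N M + 1, fun j q hq => ?_⟩
    have hle : rMultiplicity r q.2 ≤ (max N M : ℕ) := by
      rcases lt_or_ge j m with h | h
      · have h1 := hM (mem_image_of_mem _ (mem_biUnion (mem_Iio.2 h) hq))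
        -- Finiteness of the multiplicity matters here: `toNat` would send `⊤` to `0`.
        rw [← ENat.natCast_toNat (rMultiplicity_lt_top hr q.2).ne]
        exact_mod_cast le_max_of_le_right h1
      · obtain ⟨h1, h2, h3⟩ := hgood j q hq
        exact (hN q.1 q.2 _ h1 h2 (hm j h).le h3).trans (by exact_mod_cast le_max_left N M)
    exact lt_of_le_of_lt hle (by exact_mod_cast Nat.lt_succ_self _)
  choose! C hC using hbound
  refine ⟨C, fun Γ hΓ => ?_⟩
  obtain ⟨x, hxΓ⟩ : Γ.Nonempty := by
    obtain ⟨z, hz, rfl⟩ := hΓ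
    exact ⟨z, mem_connectedComponentIn hz⟩
  obtain ⟨Q, hQc, hxQ, hΓQ, hQd⟩ := hΓ.exists_exhaustion hcomp hconn.nonempty hxΓ
  have hlarge : ∀ A : Set Plane, IsPreconnected A → A.Nonempty →
      (∃ η > 0, ∀ y ∈ A, ∀ k ∈ K, η ≤ dist y k) → ∃ q ∈ ⋃ j, 𝓕 j, A ⊆ q.1 := by
    rintro A hA hAne ⟨η, hη, hd⟩
    obtain ⟨m, hm⟩ := hsmall η hη
    obtain ⟨q, hq, hAq⟩ := hcover m A hA hAne fun y hy k hk =>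
      (hm m le_rfl).trans_le (hd y hy k hk)
    exact ⟨q, mem_iUnion.2 ⟨m, hq⟩, hAq⟩
  have hall : ∀ q ∈ ⋃ j, 𝓕 j, IsPolygonalRegion q.1 q.2 ∧ Disjoint K q.1 ∧
      ∀ r : ℝ, 0 < r → rMultiplicity r q.2 < (C r : ℕ∞) := by
    intro q hq
    obtain ⟨j, hj⟩ := mem_iUnion.1 hq
    exact ⟨(hgood j q hj).1, (hgood j q hj).2.1, fun r hr => hC r hr j q hj⟩
  have hpre : ∀ q ∈ ⋃ j, 𝓕 j, IsPreconnected q.1 := fun q hq => by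
    rw [← (hall q hq).1.closure_interior]
    exact (hall q hq).1.connected.isPreconnected.closure
  -- A region is closed, connected and disjoint from the compact set `K`. Its union with `Q n` is
  -- connected through `x` and has positive distance from `K`, so a region on some scale contains
  -- it.
  have hstep : ∀ n, ∀ q : {q : Set Plane × C(Circle, Plane) // q ∈ ⋃ j, 𝓕 j ∧ x ∈ q.1},
      ∃ q' : {q : Set Plane × C(Circle, Plane) // q ∈ ⋃ j, 𝓕 j ∧ x ∈ q.1},
        q.1.1 ∪ Q n ⊆ q'.1.1 := by
    rintro n ⟨q, hq, hxq⟩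
    obtain ⟨η₁, hη₁, hd₁⟩ := exists_pos_le_dist_of_isClosed hcomp
      ((hall q hq).1.closure_interior ▸ isClosed_closure) (hall q hq).2.1
    obtain ⟨η₂, hη₂, hd₂⟩ := hQd n
    obtain ⟨q', hq', hsub⟩ := hlarge (q.1 ∪ Q n) ((hpre q hq).union x hxq (hxQ n) (hQc n))
      ⟨x, Or.inl hxq⟩ ⟨min η₁ η₂, lt_min hη₁ hη₂, by
        rintro y (hy | hy) k hk
        · exact (min_le_left _ _).trans (hd₁ y hy k hk)
        · exact (min_le_right _ _).trans (hd₂ y hy k hk)⟩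
    exact ⟨⟨q', hq', hsub (Or.inl hxq)⟩, hsub⟩
  choose next hnext using hstep
  obtain ⟨q₀, hq₀, hsub₀⟩ := hlarge (Q 0) (hQc 0) ⟨x, hxQ 0⟩ (hQd 0)
  -- The index `n + 1` in the recursion makes the `n`-th region contain `Q n`, starting from `Q 0 ⊆
  -- q₀.1`.
  set q : ℕ → {q : Set Plane × C(Circle, Plane) // q ∈ ⋃ j, 𝓕 j ∧ x ∈ q.1} := fun n =>
    Nat.rec ⟨q₀, hq₀, hsub₀ (hxQ 0)⟩ (fun n p => next (n + 1) p) n with hqdef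
  have hqsucc : ∀ n, (q n).1.1 ∪ Q (n + 1) ⊆ (q (n + 1)).1.1 := fun n => hnext (n + 1) (q n)
  refine ⟨fun n => (q n).1.1, fun n => (q n).1.2, fun n => (hall _ (q n).2.1).1,
    fun n => subset_union_left.trans (hqsucc n), Subset.antisymm ?_ (iUnion_subset fun n => ?_),
    fun r hr n => (hall _ (q n).2.1).2.2 r hr⟩
  · refine hΓQ.trans (iUnion_mono fun n => ?_)
    rcases n with _ | n
    · exact hsub₀
    · exact subset_union_right.trans (hqsucc n)
  · exact hΓ.subset_of_isPreconnected (hpre _ (q n).2.1)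
      (disjoint_left.1 (hall _ (q n).2.1).2.1.symm) hxΓ (q n).2.2
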